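/- Let $k$ be a non-archimedean local field of characteristic $0$ with valuation ring $R$, let $D$ be a finite-dimensional central division algebra over $k$, let $\Delta$ be its unique maximal $R$-order (the integral closure of $R$ in $D$), let $\boldsymbol\pi$ be a prime element of $\Delta$, and put $\mathfrak p=\boldsymbol\pi\Delta$. Let $n\ge 1$, and let $\mathrm{nr}:M_n(D)\to k$ be the reduced norm. A tiled order in $M_n(D)$ is an $R$-order that contains a conjugate of $\mathrm{diag}(\Delta,\dots,\Delta)$. An order $\Gamma$ that contains $\mathrm{diag}(\Delta,\dots,\Delta)$ itself has the form $\Gamma=(\mathfrak p^{\mu_{ij}})$ for a unique integer matrix $(\mu_{ij})$. Its structural invariants are $m_{ij\ell}=\mu_{ij}+\mu_{j\ell}-\mu_{i\ell}$, and its types are $t_j=\sum_{i=1}^n\mu_{ij} \bmod n$. Two such orders $\Gamma,\Gamma'$ are in the same reflection class, written $[\Gamma]=[\Gamma']$, if there is $\sigma\in S_n$ with $m'_{ij\ell}=m_{\sigma(i)\sigma(j)\sigma(\ell)}$ and $t'_i\equiv t_{\sigma(i)}\pmod n$ for all $i,j,\ell$. For $s\in\mathbb Z$ put $\xi_s=\mathrm{diag}(\boldsymbol\pi^s,1,\dots,1)$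 and $\Gamma_s=\xi_s\Gamma\xi_s^{-1}$. For a general tiled order $\Gamma$, choose $g\in\mathrm{GL}_n(D)$ such that $g\Gamma g^{-1}$ contains $\mathrm{diag}(\Delta,\dots,\Delta)$, and put $\Gamma_s=\xi_s\,g\Gamma g^{-1}\,\xi_s^{-1}$. **Theorem.** Let $\Gamma\subset M_n(D)$ be a tiled order, let $g$ be any such choice, and let $d\ge 0$ be an integer. The following are equivalent: (a) there are exactly $d$ distinct classes among $[\Gamma_0],[\Gamma_1],\dots,[\Gamma_{n-1}]$; (b) $d$ is the least element $e$ of $\{1,\dots,n\}$ such that $[\Gamma_s]=[\Gamma_t]$ for all $s,t\in\mathbb Z$ with $s\equiv t\pmod e$; (c) $d$ is the least element $e$ of $\{1,\dots,n\}$ such that $[\Gamma_0]=[\Gamma_e]$; (d) $\mathrm{nr}(\mathcal N(\Gamma))=(k^\times)^dR^\times$, where $\mathcal N(\Gamma)=\{\xi\in \mathrm{GL}_n(D):\xi\Gamma\xi^{-1}=\Gamma\}$ and $(k^\times)^d=\{a^d:a\in k^\times\}$. -/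

import Mathlib

open scoped TensorProduct ValuativeRel

noncomputable section

namespace TiledOrder

/-- `c` is a value of the reduced norm of `a`: the determinant of `1 ⊗ a` under a splitting
`k̄ ⊗ A ≃ M_m(k̄)` of `A` over an algebraic closure of `k`. -/
def IsReducedNorm (k : Type*) {A : Type*} [Field k] [Ring A] [Algebra k A] (a : A) (c : k) :
    Prop :=
  ∃ (m : ℕ) (φ : (AlgebraicClosure k ⊗[k] A) ≃ₐ[AlgebraicClosure k]
      Matrix (Fin m) (Fin m) (AlgebraicClosure k)),
    (φ (1 ⊗ₜ[k] a)).det = algebraMap k (AlgebraicClosure k) c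

open Classical in
/-- The reduced norm `nr : A → k` of a central simple algebra `A` over `k`: the unique `c : k`
with `IsReducedNorm k a c` (a junk value if there is none, which does not happen for central
simple algebras). -/
def reducedNorm (k : Type*) {A : Type*} [Field k] [Ring A] [Algebra k A] (a : A) : k :=
  if h : ∃ c : k, IsReducedNorm k a c then h.choose else 0

section

variable (k : Type*) [Field k] [ValuativeRel k]

/-- The set `(k^×)^d R^×`, where `R` is the valuation ring of `k`. -/
def powMulUnits (d : ℕ) : Set k :=
  {y | ∃ (a : kˣ) (u : (𝒪[k])ˣ), y = (a : k) ^ d * ((u : 𝒪[k]) : k)}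

/-- `Γ` is an `R`-order in the `k`-algebra `A` (with `R` the valuation ring of `k`): a subring
containing `R`, finitely generated as an `R`-module and spanning `A` over `k`. -/
structure IsOrder {A : Type*} [Ring A] [Algebra k A] (Γ : Subalgebra 𝒪[k] A) : Prop where
  fg : (Subalgebra.toSubmodule Γ).FG
  span_eq_top : Submodule.span k (Γ : Set A) = ⊤

variable {k}

/-- The conjugate `g Γ g⁻¹`. -/
def conj {A : Type*} [Ring A] [Algebra k A] (g : Aˣ) (Γ : Subalgebra 𝒪[k] A) :
    Subalgebra 𝒪[k] A where
  carrier := {x | (↑g⁻¹ : A) * x * (g : A) ∈ Γ}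
  mul_mem' {x y} hx hy := by
    have h := Γ.mul_mem hx hy
    have e : (↑g⁻¹ : A) * x * g * (↑g⁻¹ * y * g) = ↑g⁻¹ * (x * y) * g := by
      simp [mul_assoc]
    rw [e] at h
    exact h
  add_mem' {x y} hx hy := by
    have h := Γ.add_mem hx hy
    rw [← add_mul, ← mul_add] at h
    exact h
  algebraMap_mem' r := by
    have h := Γ.algebraMap_mem r
    have e : (↑g⁻¹ : A) * algebraMap 𝒪[k] A r * g = algebraMap 𝒪[k] A r := by
      rw [← Algebra.commutes r (↑g⁻¹ : A), mul_assoc, Units.inv_mul, mul_one]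
    change (↑g⁻¹ : A) * algebraMap 𝒪[k] A r * g ∈ Γ
    rw [e]
    exact h

/-- The normalizer `N(Γ) = {ξ ∈ A^× | ξ Γ ξ⁻¹ = Γ}`. -/
def normalizer {A : Type*} [Ring A] [Algebra k A] (Γ : Subalgebra 𝒪[k] A) : Set Aˣ :=
  {g | conj g Γ = Γ}

variable {D : Type*} [DivisionRing D] [Algebra k D]

variable (k D) in
/-- The underlying set of the unique maximal `R`-order `Δ` of the division algebra `D`, that is,
of the integral closure of `R` in `D`. -/
def maxOrder : Set D := {x | IsIntegral 𝒪[k] x}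

variable (k) in
/-- The fractional ideal `𝔭 ^ m = ϖ ^ m Δ` of `D`, for `m ∈ ℤ`. -/
def primePow (ϖ : Dˣ) (m : ℤ) : Set D := {x | ((ϖ ^ (-m) : Dˣ) : D) * x ∈ maxOrder k D}

variable (k) in
/-- `ϖ` is a prime element of `Δ`: `ϖ Δ` is the set of the non-units of the local ring `Δ`. -/
def IsPrimeElement (ϖ : Dˣ) : Prop :=
  ∀ x : D, x ∈ primePow k ϖ 1 ↔ x ∈ maxOrder k D ∧ ¬ (x ≠ 0 ∧ x⁻¹ ∈ maxOrder k D)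

variable {n : ℕ}

/-- `Γ ⊆ M_n(D)` contains `diag(Δ, …, Δ)`. -/
def ContainsDiag (Γ : Subalgebra 𝒪[k] (Matrix (Fin n) (Fin n) D)) : Prop :=
  ∀ δ : Fin n → D, (∀ i, δ i ∈ maxOrder k D) → Matrix.diagonal δ ∈ Γ

/-- `Γ` is a tiled order in `M_n(D)`: an order that contains a conjugate of `diag(Δ, …, Δ)`. -/
def IsTiled (Γ : Subalgebra 𝒪[k] (Matrix (Fin n) (Fin n) D)) : Prop :=
  IsOrder k Γ ∧ ∃ g : GL (Fin n) D, ContainsDiag (conj g Γ)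

/-- `Γ = (𝔭 ^ μ_ij)`. -/
def IsExponentMatrix (ϖ : Dˣ) (Γ : Subalgebra 𝒪[k] (Matrix (Fin n) (Fin n) D))
    (μ : Matrix (Fin n) (Fin n) ℤ) : Prop :=
  ∀ x : Matrix (Fin n) (Fin n) D, x ∈ Γ ↔ ∀ i j, x i j ∈ primePow k ϖ (μ i j)

open Classical in
/-- The exponent matrix `(μ_ij)` of an order `Γ = (𝔭 ^ μ_ij)` (every order that contains
`diag(Δ, …, Δ)` has this form, for a unique `μ`; the value is junk for other subalgebras). -/
def exponentMatrix (ϖ : Dˣ) (Γ : Subalgebra 𝒪[k] (Matrix (Fin n) (Fin n) D)) :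
    Matrix (Fin n) (Fin n) ℤ :=
  if h : ∃ μ, IsExponentMatrix ϖ Γ μ then h.choose else 0

/-- The structural invariants `m_ijl = μ_ij + μ_jl - μ_il`. -/
def structInv (ϖ : Dˣ) (Γ : Subalgebra 𝒪[k] (Matrix (Fin n) (Fin n) D)) (i j l : Fin n) : ℤ :=
  exponentMatrix ϖ Γ i j + exponentMatrix ϖ Γ j l - exponentMatrix ϖ Γ i l

/-- The type `t[a_1, …, a_n] = a_1 + ⋯ + a_n mod n` of the vertex `[a_1, …, a_n]` of the standard
apartment, that is, of the homothety class of the lattice `⊕ e_i 𝔭 ^ a_i`. -/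
def vertexType (a : Fin n → ℤ) : ZMod n := ((∑ i, a i : ℤ) : ZMod n)

/-- The type `t_j` of the distinguished vertex `P_j = [μ_1j, …, μ_nj]` of `Γ`. -/
def distinguishedType (ϖ : Dˣ) (Γ : Subalgebra 𝒪[k] (Matrix (Fin n) (Fin n) D)) (j : Fin n) :
    ZMod n :=
  vertexType fun i => exponentMatrix ϖ Γ i j

/-- `Γ ∼ Γ'` when a permutation `σ` satisfies `m'_ijl = m_{σ(i)σ(j)σ(l)}` and
`t'_i = t_{σ(i)} mod n`. -/
def reflectionSetoid (ϖ : Dˣ) : Setoid (Subalgebra 𝒪[k] (Matrix (Fin n) (Fin n) D)) where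
  r Γ Γ' := ∃ σ : Equiv.Perm (Fin n),
    (∀ i j l, structInv ϖ Γ' i j l = structInv ϖ Γ (σ i) (σ j) (σ l)) ∧
    ∀ i, distinguishedType ϖ Γ' i = distinguishedType ϖ Γ (σ i)
  iseqv :=
    { refl := fun _ => ⟨1, by simp, by simp⟩
      symm := by
        rintro _ _ ⟨σ, h1, h2⟩
        exact ⟨σ⁻¹, by simp [h1], by simp [h2]⟩
      trans := by
        rintro _ _ _ ⟨σ, h1, h2⟩ ⟨τ, h3, h4⟩
        exact ⟨σ * τ, by simp [h1, h3], by simp [h2, h4]⟩ }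

/-- The matrix `ξ_s = diag(ϖ ^ s, 1, …, 1)`. -/
def xi [NeZero n] (ϖ : Dˣ) (s : ℤ) : GL (Fin n) D :=
  Units.map (Matrix.diagonalRingHom (Fin n) D).toMonoidHom
    (MulEquiv.piUnits.symm (Pi.mulSingle 0 (ϖ ^ s)))

/-- The reflection class `[Γ_s]` of `Γ_s = ξ_s Γ ξ_s⁻¹`. -/
def reflectionClass [NeZero n] (ϖ : Dˣ) (Γ : Subalgebra 𝒪[k] (Matrix (Fin n) (Fin n) D))
    (s : ℤ) :
    Quotient (reflectionSetoid (k := k) (D := D) (n := n) ϖ) :=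
  Quotient.mk _ (conj (xi ϖ s) Γ)

end

end TiledOrder

end

/-!
The proof determines one positive integer `e` such that each of the four statements
says that `d = e`. After conjugation by `g` the order is `Γ = (𝔭 ^ μ_ij)`
(`exists_isExponentMatrix`). Consider the pairs of a permutation `σ` and a vector `b` of integers
with `μ (σ i) (σ j) = μ i j + b i - b j` for all `i, j`. The sums `∑ b i` form a subgroup
`shiftGroup μ` of `ℤ`. It contains `n`, so it is `e ℤ` with `1 ≤ e ≤ n`.

*Reflection classes.* Conjugation by `ξ_s` preserves the structural invariants and adds `s` to all
types. A permutation `σ` preserves the structural invariants if and only if it admits a vector `b` as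
above; `b` is then unique up to constants, which change `∑ b i` by multiples of `n`, and `σ` changes
the types by `∑ b i`. So `[Γ_s] = [Γ_t]` if and only if `t - s ∈ e ℤ`
(`IsExponentMatrix.reflectionClass_eq_iff`), and this settles the first three statements.

*Reduced norms.* A pair `(σ, b)` as above gives the monomial matrix with entries `ϖ ^ b_j` in
the positions `(σ j, j)`. It normalizes `Γ`, and its reduced norm has valuation `∑ b i`, because
`nr ϖ` is a uniformizer of `k`. Conversely the quotient of any element `ξ` of the normalizer by some
such matrix is a unit of `Γ`, and therefore has its reduced norm in `Rˣ`
(`IsExponentMatrix.exists_monomial_of_mem_normalizer`). The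
permutation is found as follows: the entries of `ξ Γ ξ⁻¹ = Γ` yield inequalities between the orders
of the entries of `ξ`, of `ξ⁻¹`, and of `μ`, which single out a dominant entry in every column of
`ξ`; the rows of these entries form a permutation up to the equivalence `μ i j + μ j i = 0`, as is
seen from a determinant over the residue field. Finally, `Rˣ` consists of reduced norms of
elements of `Δˣ` (`exists_reducedNorm_eq`), hence of elements `diag(x, 1, …, 1)` of the normalizer,
so that the reduced norms of the normalizer are exactly the elements with valuation in `e ℤ`.

*Division algebras over local fields.* The arithmetic of `D` rests on its splitting by an algebraic
closure of `k` (`exists_splitting`) and on the theorem of Skolem and Noether (`det_splitting_eq`).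
They show that the reduced norm is well defined, multiplicative, and a product of roots of
the minimal polynomial. Hence an element is integral if and only if its reduced norm
is (`isIntegral_iff_reducedNorm_mem`), and `ord = val ∘ nr` is a valuation of `D`. For
`D` of degree `m` the ramification index and the residue degree are at most `m`, and their product
is at least `m ^ 2` by completeness, so both are equal to `m` (`ord_prime_and_natDegree`). This
gives `ord ϖ = 1`, and an unramified subfield of degree `m` whose norms, by Hensel's lemma, exhaust
`Rˣ`.
-/

noncomputable section

namespace TiledOrder

/-! ### Splittings of division algebras -/

section Splitting

variable {k : Type*} [Field k]

theorem equivFinsuppOfBasisLeft_mul_one_tmul {K D ι : Type*} [DecidableEq ι] [Field K]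
    [Algebra k K] [Ring D] [Algebra k D] (b : Module.Basis ι k K) (z : K ⊗[k] D) (d : D) (i : ι) :
    TensorProduct.equivFinsuppOfBasisLeft b (z * (1 ⊗ₜ[k] d)) i =
      TensorProduct.equivFinsuppOfBasisLeft b z i * d := by
  induction z with
  | zero => simp
  | add x y hx hy => simp [add_mul, hx, hy]
  | tmul a e => simp

theorem equivFinsuppOfBasisLeft_one_tmul_mul {K D ι : Type*} [DecidableEq ι] [Field K]
    [Algebra k K] [Ring D] [Algebra k D] (b : Module.Basis ι k K) (z : K ⊗[k] D) (d : D) (i : ι) :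
    TensorProduct.equivFinsuppOfBasisLeft b ((1 ⊗ₜ[k] d) * z) i =
      d * TensorProduct.equivFinsuppOfBasisLeft b z i := by
  induction z with
  | zero => simp
  | add x y hx hy => simp [mul_add, hx, hy]
  | tmul a e => simp

/-- A scalar extension of a central division algebra is simple: in a nonzero two-sided ideal an
element with the fewest nonzero coordinates, one of them equal to `1`, commutes with `D`, so that
its coordinates are central. -/
theorem isSimpleRing_tensorProduct (K D : Type*) [Field K] [Algebra k K] [DivisionRing D]
    [Algebra k D] [Algebra.IsCentral k D] : IsSimpleRing (K ⊗[k] D) := by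
  classical
  let b := Module.Free.chooseBasis k K
  let e := TensorProduct.equivFinsuppOfBasisLeft (N := D) b
  refine ⟨{ toNontrivial := ⟨⊥, ⊤, ?_⟩, eq_bot_or_eq_top := fun I => ?_ }⟩
  · intro h
    have : (1 : K ⊗[k] D) ∈ (⊥ : TwoSidedIdeal (K ⊗[k] D)) := h ▸ trivial
    rw [TwoSidedIdeal.mem_bot] at this
    exact one_ne_zero this
  by_cases hI : I = ⊥
  · exact Or.inl hI
  right
  have hne : ∃ z ∈ I, z ≠ 0 := by
    by_contra! h
    exact hI (eq_bot_iff.mpr fun z hz => (TwoSidedIdeal.mem_bot _).mpr (h z hz))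
  let P : ℕ → Prop := fun N => ∃ z ∈ I, z ≠ 0 ∧ (e z).support.card = N
  have hP : ∃ N, P N := by
    obtain ⟨z, hz, hz0⟩ := hne
    exact ⟨_, z, hz, hz0, rfl⟩
  obtain ⟨z, hzI, hz0, hzN⟩ := Nat.find_spec hP
  have hez : e z ≠ 0 := by simpa using hz0
  obtain ⟨i0, hi0⟩ := Finsupp.ne_iff.mp hez
  simp only [Finsupp.coe_zero, Pi.zero_apply] at hi0
  set y := z * (1 ⊗ₜ[k] (e z i0)⁻¹) with hy
  have hyI : y ∈ I := I.mul_mem_right _ _ hzI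
  have hyc : ∀ i, e y i = e z i * (e z i0)⁻¹ := fun i =>
    equivFinsuppOfBasisLeft_mul_one_tmul b z _ i
  have hy1 : e y i0 = 1 := by rw [hyc, mul_inv_cancel₀ hi0]
  have hcomm : ∀ d i, d * e y i = e y i * d := by
    intro d
    set w := (1 ⊗ₜ[k] d) * y - y * (1 ⊗ₜ[k] d) with hw
    have hwI : w ∈ I := I.sub_mem (I.mul_mem_left _ _ hyI) (I.mul_mem_right _ _ hyI)
    have hwc : ∀ i, e w i = d * e y i - e y i * d := fun i => by
      rw [hw, map_sub, Finsupp.sub_apply]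
      exact congrArg₂ _ (equivFinsuppOfBasisLeft_one_tmul_mul b y d i)
        (equivFinsuppOfBasisLeft_mul_one_tmul b y d i)
    have hw0 : w = 0 := by
      by_contra hw0
      refine Nat.find_min hP (m := (e w).support.card) ?_ ⟨w, hwI, hw0, rfl⟩
      rw [← hzN]
      refine Finset.card_lt_card (Finset.ssubset_iff_of_subset ?_ |>.mpr ⟨i0, ?_, ?_⟩)
      · intro i hi
        rw [Finsupp.mem_support_iff] at hi ⊢
        intro h
        exact hi (by rw [hwc, hyc, h]; simp)
      · simpa using hi0
      · simp [hwc, hy1]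
    intro i
    have := hwc i
    rw [hw0, map_zero, Finsupp.zero_apply] at this
    exact (sub_eq_zero.mp this.symm)
  have hcen : ∀ i, ∃ c : k, algebraMap k D c = e y i := fun i => by
    have : e y i ∈ Subalgebra.center k D :=
      Subalgebra.mem_center_iff.mpr fun d => hcomm d i
    simpa [Algebra.IsCentral.center_eq_bot, Algebra.mem_bot] using this
  choose c hc using hcen
  have hyt : y = ((e y).sum fun i _ => c i • b i) ⊗ₜ[k] (1 : D) := by
    conv_lhs => rw [← e.symm_apply_apply y]
    rw [TensorProduct.equivFinsuppOfBasisLeft_symm_apply, Finsupp.sum, Finsupp.sum,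
      TensorProduct.sum_tmul]
    refine Finset.sum_congr rfl fun i _ => ?_
    rw [TensorProduct.smul_tmul, ← hc i, Algebra.algebraMap_eq_smul_one]
  set a := (e y).sum fun i _ => c i • b i with ha
  have ha0 : a ≠ 0 := by
    intro h
    rw [h, TensorProduct.zero_tmul] at hyt
    rw [hyt] at hy1
    simp at hy1
  rw [← TwoSidedIdeal.one_mem_iff]
  have := I.mul_mem_left (a⁻¹ ⊗ₜ[k] (1 : D)) _ hyI
  rwa [hyt, Algebra.TensorProduct.tmul_mul_tmul, inv_mul_cancel₀ ha0, one_mul,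
    ← Algebra.TensorProduct.one_def] at this

/-- The scalar extension of `D` to an algebraic closure is simple, hence a matrix algebra. -/
theorem exists_splitting (D : Type*) [DivisionRing D] [Algebra k D] [Algebra.IsCentral k D]
    [FiniteDimensional k D] :
    ∃ m : ℕ, m ≠ 0 ∧ m * m = Module.finrank k D ∧
      Nonempty ((AlgebraicClosure k ⊗[k] D) ≃ₐ[AlgebraicClosure k]
        Matrix (Fin m) (Fin m) (AlgebraicClosure k)) := by
  have := isSimpleRing_tensorProduct (k := k) (AlgebraicClosure k) D
  obtain ⟨m, hm, ⟨φ⟩⟩ := IsSimpleRing.exists_algEquiv_matrix_of_isAlgClosed (AlgebraicClosure k)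
    (AlgebraicClosure k ⊗[k] D)
  refine ⟨m, hm.ne, ?_, ⟨φ⟩⟩
  have h := φ.toLinearEquiv.finrank_eq
  rw [Module.finrank_baseChange, Module.finrank_matrix] at h
  simpa using h.symm

/-- Two splittings of an algebra give the same determinants, by the theorem of Skolem and
Noether. -/
theorem det_splitting_eq {K B : Type*} [Field K] [Ring B] [Algebra K B] {m m' : ℕ}
    (φ : B ≃ₐ[K] Matrix (Fin m) (Fin m) K) (ψ : B ≃ₐ[K] Matrix (Fin m') (Fin m') K) (x : B) :
    (φ x).det = (ψ x).det := by
  obtain ⟨T, hT⟩ := AlgEquiv.eq_linearEquivConjAlgEquiv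
    ((Matrix.toLinAlgEquiv' (R := K) (n := Fin m)).symm.trans
      (φ.symm.trans (ψ.trans (Matrix.toLinAlgEquiv' (R := K) (n := Fin m')))))
  have h := DFunLike.congr_fun hT (Matrix.toLinAlgEquiv' (φ x))
  simp only [AlgEquiv.trans_apply, AlgEquiv.symm_apply_apply] at h
  have h2 := congrArg LinearMap.det h
  rw [LinearEquiv.conjAlgEquiv_apply, ← LinearMap.comp_assoc] at h2
  have h3 := LinearMap.det_conj (Matrix.toLinAlgEquiv' (φ x)) T
  rw [← LinearMap.comp_assoc] at h3
  rw [h3] at h2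
  have e1 : ∀ {j : ℕ} (M : Matrix (Fin j) (Fin j) K),
      LinearMap.det (Matrix.toLinAlgEquiv' M) = M.det := fun M => LinearMap.det_toLin' M
  rw [e1, e1] at h2
  exact h2.symm

end Splitting

/-! ### The reduced norm -/

section ReducedNorm

variable {k : Type*} [Field k] {A : Type*} [Ring A] [Algebra k A]

/-- The determinant of `1 ⊗ a` is fixed by the Galois group: an automorphism `σ` carries a splitting
to another one, which has the same determinants. -/
theorem exists_algebraMap_eq_det_splitting [CharZero k] {m : ℕ}
    (φ : (AlgebraicClosure k ⊗[k] A) ≃ₐ[AlgebraicClosure k]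
      Matrix (Fin m) (Fin m) (AlgebraicClosure k)) (a : A) :
    ∃ c : k, algebraMap k (AlgebraicClosure k) c = (φ (1 ⊗ₜ[k] a)).det := by
  have : IsGalois k (AlgebraicClosure k) := {}
  rw [← Set.mem_range, InfiniteGalois.mem_range_algebraMap_iff_fixed]
  intro σ
  let s : (AlgebraicClosure k ⊗[k] A) ≃ₐ[k] (AlgebraicClosure k ⊗[k] A) :=
    Algebra.TensorProduct.congr σ AlgEquiv.refl
  let ψ : (AlgebraicClosure k ⊗[k] A) ≃ₐ[AlgebraicClosure k]
      Matrix (Fin m) (Fin m) (AlgebraicClosure k) :=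
    AlgEquiv.ofRingEquiv (f := s.symm.toRingEquiv.trans
      (φ.toRingEquiv.trans σ.toRingEquiv.mapMatrix)) (fun r => by
        have h1 : s.symm (algebraMap _ _ r) = algebraMap _ _ (σ.symm r) := by
          rw [AlgEquiv.symm_apply_eq]
          simp [s, Algebra.TensorProduct.algebraMap_apply]
        change (φ (s.symm (algebraMap _ _ r))).map σ = _
        rw [h1, AlgEquiv.commutes, Matrix.algebraMap_eq_diagonal, Matrix.algebraMap_eq_diagonal]
        ext i j
        by_cases h : i = j <;> simp [h, Matrix.diagonal])
  have h2 : ψ (1 ⊗ₜ[k] a) = (φ (1 ⊗ₜ[k] a)).map σ := by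
    have h1 : s.symm (1 ⊗ₜ[k] a) = 1 ⊗ₜ[k] a := by
      rw [AlgEquiv.symm_apply_eq]
      simp [s]
    change (φ (s.symm (1 ⊗ₜ[k] a))).map σ = _
    rw [h1]
  have h3 := det_splitting_eq ψ φ (1 ⊗ₜ[k] a)
  rw [h2] at h3
  refine Eq.trans ?_ h3
  exact RingHom.map_det σ.toAlgHom.toRingHom _

/-- The reduced norm can be computed by any splitting. -/
theorem algebraMap_reducedNorm [CharZero k] {m : ℕ}
    (φ : (AlgebraicClosure k ⊗[k] A) ≃ₐ[AlgebraicClosure k]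
      Matrix (Fin m) (Fin m) (AlgebraicClosure k)) (a : A) :
    algebraMap k (AlgebraicClosure k) (reducedNorm k a) = (φ (1 ⊗ₜ[k] a)).det := by
  have h : ∃ c : k, IsReducedNorm k a c := by
    obtain ⟨c, hc⟩ := exists_algebraMap_eq_det_splitting φ a
    exact ⟨c, m, φ, hc.symm⟩
  rw [reducedNorm, dif_pos h]
  obtain ⟨m', ψ, hψ⟩ := h.choose_spec
  rw [← hψ, det_splitting_eq φ ψ]

section

variable [CharZero k] {m : ℕ}
    (φ : (AlgebraicClosure k ⊗[k] A) ≃ₐ[AlgebraicClosure k]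
      Matrix (Fin m) (Fin m) (AlgebraicClosure k))

include φ in
theorem reducedNorm_mul (a b : A) :
    reducedNorm k (a * b) = reducedNorm k a * reducedNorm k b := by
  apply (algebraMap k (AlgebraicClosure k)).injective
  rw [map_mul, algebraMap_reducedNorm φ, algebraMap_reducedNorm φ, algebraMap_reducedNorm φ,
    ← Matrix.det_mul, ← map_mul]
  simp

include φ in
theorem reducedNorm_algebraMap (c : k) : reducedNorm k (algebraMap k A c) = c ^ m := by
  apply (algebraMap k (AlgebraicClosure k)).injective
  rw [algebraMap_reducedNorm φ]
  have : (1 : AlgebraicClosure k) ⊗ₜ[k] algebraMap k A c =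
      algebraMap (AlgebraicClosure k) _ (algebraMap k (AlgebraicClosure k) c) := by
    rw [Algebra.TensorProduct.algebraMap_apply, Algebra.algebraMap_eq_smul_one,
      ← TensorProduct.smul_tmul, Algebra.algebraMap_eq_smul_one,
      algebraMap_smul]
  rw [this, AlgEquiv.commutes, Matrix.algebraMap_eq_diagonal]
  simp

include φ in
theorem reducedNorm_one : reducedNorm k (1 : A) = 1 := by
  simpa using reducedNorm_algebraMap φ 1

end

/-- A splitting of `D` gives a splitting of `M_n(D)` by block matrices. -/
theorem exists_matrix_splitting {D : Type*} [Ring D] [Algebra k D] {m : ℕ}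
    (φ : (AlgebraicClosure k ⊗[k] D) ≃ₐ[AlgebraicClosure k]
      Matrix (Fin m) (Fin m) (AlgebraicClosure k)) (n : ℕ) :
    ∃ Φ : (AlgebraicClosure k ⊗[k] Matrix (Fin n) (Fin n) D) ≃ₐ[AlgebraicClosure k]
      Matrix (Fin (n * m)) (Fin (n * m)) (AlgebraicClosure k), ∀ x : Matrix (Fin n) (Fin n) D,
        Φ (1 ⊗ₜ[k] x) = Matrix.reindex finProdFinEquiv finProdFinEquiv
          (Matrix.comp _ _ _ _ _ (x.map fun d => φ (1 ⊗ₜ[k] d))) := by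
  let K := AlgebraicClosure k
  -- the first factor `K` is written as a matrix algebra of size `1`
  let e1 : K ⊗[k] Matrix (Fin n) (Fin n) D ≃ₐ[K] Matrix Unit Unit K ⊗[k] Matrix (Fin n) (Fin n) D :=
    Algebra.TensorProduct.congr (Matrix.uniqueAlgEquiv (R := K) (A := K) (m := Unit)).symm
      AlgEquiv.refl
  let e2 : Matrix Unit Unit K ⊗[k] Matrix (Fin n) (Fin n) D ≃ₐ[K]
      Matrix (Unit × Fin n) (Unit × Fin n) (K ⊗[k] D) :=
    Matrix.kroneckerTMulAlgEquiv (Unit) (Fin n) k K K D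
  let e3 : Matrix (Unit × Fin n) (Unit × Fin n) (K ⊗[k] D) ≃ₐ[K]
      Matrix (Fin n) (Fin n) (K ⊗[k] D) :=
    Matrix.reindexAlgEquiv _ _ (Equiv.uniqueProd (Fin n) Unit)
  refine ⟨e1.trans (e2.trans (e3.trans ((AlgEquiv.mapMatrix φ).trans
    ((Matrix.compAlgEquiv _ _ _ _).trans (Matrix.reindexAlgEquiv _ _ finProdFinEquiv))))), ?_⟩
  intro x
  ext i j
  simp [e1, e2, e3]

theorem reducedNorm_diagonal [CharZero k] {D : Type*} [Ring D] [Algebra k D] {m : ℕ}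
    (φ : (AlgebraicClosure k ⊗[k] D) ≃ₐ[AlgebraicClosure k]
      Matrix (Fin m) (Fin m) (AlgebraicClosure k)) {n : ℕ} (δ : Fin n → D) :
    reducedNorm k (Matrix.diagonal δ) = ∏ i, reducedNorm k (δ i) := by
  apply (algebraMap k (AlgebraicClosure k)).injective
  obtain ⟨Φ, hΦ⟩ := exists_matrix_splitting φ n
  rw [algebraMap_reducedNorm Φ, hΦ, map_prod]
  simp_rw [algebraMap_reducedNorm φ]
  rw [Matrix.det_reindex_self, ← Matrix.det_blockDiagonal,
    ← Matrix.det_reindex_self (Equiv.prodComm _ _)]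
  congr 1
  ext ⟨i, a⟩ ⟨j, b⟩
  by_cases h : a = b
  · subst h; simp [Matrix.blockDiagonal_apply]
  · simp [Matrix.blockDiagonal_apply, h]

end ReducedNorm

/-! ### Reduced norms and minimal polynomials -/

section ReducedNorm

open Polynomial

variable {k : Type*} [Field k] {A : Type*} [Ring A] [Algebra k A] {m : ℕ}
    (φ : (AlgebraicClosure k ⊗[k] A) ≃ₐ[AlgebraicClosure k]
      Matrix (Fin m) (Fin m) (AlgebraicClosure k))

theorem aeval_splitting (a : A) (P : k[X]) :
    aeval (φ (1 ⊗ₜ[k] a)) (P.map (algebraMap k (AlgebraicClosure k))) =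
      φ (1 ⊗ₜ[k] aeval a P) := by
  have h : aeval (1 ⊗ₜ[k] a : AlgebraicClosure k ⊗[k] A) P = 1 ⊗ₜ[k] aeval a P :=
    aeval_algHom_apply
      (Algebra.TensorProduct.includeRight : A →ₐ[k] AlgebraicClosure k ⊗[k] A) a P
  rw [aeval_algHom_apply, aeval_map_algebraMap, h]

/-- The eigenvalues of a matrix that represents `a` are roots of the polynomials that
annihilate `a`. -/
theorem eval_eq_zero_of_mem_roots_charpoly {a : A} {P : k[X]} (hP : aeval a P = 0)
    {r : AlgebraicClosure k} (hr : r ∈ (φ (1 ⊗ₜ[k] a)).charpoly.roots) : aeval r P = 0 := by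
  have h1 := Matrix.mem_spectrum_of_isRoot_charpoly (isRoot_of_mem_roots hr)
  have h2 := spectrum.subset_polynomial_aeval (φ (1 ⊗ₜ[k] a))
    (P.map (algebraMap k (AlgebraicClosure k))) ⟨r, h1, rfl⟩
  rw [aeval_splitting, hP, TensorProduct.tmul_zero, map_zero] at h2
  have : Nontrivial (Matrix (Fin m) (Fin m) (AlgebraicClosure k)) := by
    by_contra h
    rw [not_nontrivial_iff_subsingleton] at h
    simp [spectrum.of_subsingleton] at h2
  rw [spectrum.zero_eq] at h2
  rw [← eval_map_algebraMap]
  simpa using h2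

include φ in
/-- The reduced norm of an integral element is a product of roots of an integral equation. -/
theorem isIntegral_reducedNorm [CharZero k] {R : Type*} [CommRing R] [Algebra R k] [Algebra R A]
    [IsScalarTower R k A] {a : A} (ha : IsIntegral R a) : IsIntegral R (reducedNorm k a) := by
  obtain ⟨P, hP, hPa⟩ := ha
  have hPa' : aeval a (P.map (algebraMap R k)) = 0 := by
    rw [aeval_map_algebraMap]; exact hPa
  rw [← isIntegral_algebraMap_iff (algebraMap k (AlgebraicClosure k)).injective,
    algebraMap_reducedNorm φ, Matrix.det_eq_prod_roots_charpoly]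
  refine IsIntegral.multiset_prod fun r hr => ⟨P, hP, ?_⟩
  have := eval_eq_zero_of_mem_roots_charpoly φ hPa' hr
  rwa [aeval_map_algebraMap] at this

/-- The minimal polynomial does not change under scalar extension, because the powers of `a` below
its degree remain linearly independent. -/
theorem minpoly_splitting [Nontrivial A] [FiniteDimensional k A] (a : A) :
    minpoly (AlgebraicClosure k) (φ (1 ⊗ₜ[k] a)) =
      (minpoly k a).map (algebraMap k (AlgebraicClosure k)) := by
  classical
  have hint : IsIntegral k a := Algebra.IsIntegral.isIntegral a
  refine (minpoly.unique' _ _ ((minpoly.monic hint).map _) ?_ ?_).symm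
  · rw [aeval_splitting, minpoly.aeval, TensorProduct.tmul_zero, map_zero]
  intro q hq
  rw [or_iff_not_imp_right, not_not]
  intro hqa
  let b := Module.Free.chooseBasis k (AlgebraicClosure k)
  let e := TensorProduct.equivFinsuppOfBasisLeft (N := A) b
  have hd : q.natDegree < (minpoly k a).natDegree := by
    rw [degree_map] at hq
    by_cases h0 : q = 0
    · rw [h0, natDegree_zero]
      exact minpoly.natDegree_pos hint
    · exact natDegree_lt_natDegree h0 hq
  have h1 : ∑ i ∈ Finset.range (minpoly k a).natDegree, q.coeff i ⊗ₜ[k] (a ^ i) = 0 := by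
    apply φ.injective
    rw [map_zero, ← hqa, aeval_eq_sum_range' hd, map_sum]
    refine Finset.sum_congr rfl fun i _ => ?_
    rw [← map_pow, ← map_smul, Algebra.TensorProduct.tmul_pow, one_pow, TensorProduct.smul_tmul',
      smul_eq_mul, mul_one]
  have h2 : ∀ j, ∑ i ∈ Finset.range (minpoly k a).natDegree, b.repr (q.coeff i) j • a ^ i = 0 := by
    intro j
    have := congrArg (fun z => e z j) h1
    simpa [e, map_sum, Finsupp.finsetSum_apply] using this
  ext i
  rw [coeff_zero]
  rcases lt_or_ge i (minpoly k a).natDegree with hi | hi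
  · apply b.repr.injective
    ext j
    have h3 := linearIndependent_pow (K := k) a
    rw [Fintype.linearIndependent_iff] at h3
    have := h3 (fun i => b.repr (q.coeff i) j) (by
      rw [← h2 j, Finset.sum_range]) ⟨i, hi⟩
    simpa using this
  · exact coeff_eq_zero_of_natDegree_lt (hd.trans_le hi)

include φ in
theorem natDegree_minpoly_le [Nontrivial A] [FiniteDimensional k A] (a : A) :
    (minpoly k a).natDegree ≤ m := by
  have h := natDegree_le_of_dvd (Matrix.minpoly_dvd_charpoly (φ (1 ⊗ₜ[k] a)))
    (Matrix.charpoly_monic _).ne_zero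
  rwa [minpoly_splitting, natDegree_map, Matrix.charpoly_natDegree_eq_dim, Fintype.card_fin] at h

include φ in
/-- If `a` generates a subfield of the largest possible degree, then its reduced norm is its
norm from that subfield. -/
theorem reducedNorm_eq_of_natDegree_minpoly [CharZero k] [Nontrivial A] [FiniteDimensional k A]
    {a : A} (ha : (minpoly k a).natDegree = m) :
    reducedNorm k a = (-1) ^ m * (minpoly k a).coeff 0 := by
  have h : (φ (1 ⊗ₜ[k] a)).charpoly = (minpoly k a).map (algebraMap k (AlgebraicClosure k)) := by
    rw [← minpoly_splitting φ]
    refine (eq_of_monic_of_dvd_of_natDegree_le (minpoly.monic (Algebra.IsIntegral.isIntegral _))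
      (Matrix.charpoly_monic _) (Matrix.minpoly_dvd_charpoly _) ?_)
    rw [minpoly_splitting, natDegree_map, Matrix.charpoly_natDegree_eq_dim, Fintype.card_fin, ha]
  apply (algebraMap k (AlgebraicClosure k)).injective
  rw [algebraMap_reducedNorm φ, Matrix.det_eq_sign_charpoly_coeff, h]
  simp

end ReducedNorm

/-! ### Valuations of local fields and integrality in division algebras -/

section LocalField

open Polynomial ValuativeRel

variable (k : Type*) [Field k] [ValuativeRel k] [TopologicalSpace k]
    [IsNonarchimedeanLocalField k]

/-- The absolute value of a local field extends to an absolute value of its algebraic closure, which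
is constant on the set of roots of an irreducible polynomial `P` and is at most `1` there only if
`P` has integral coefficients. -/
theorem exists_spectral_absoluteValue : ∃ f : AlgebraicClosure k →*₀ ℝ, (∀ y, 0 ≤ f y) ∧
    (∀ c : k, f (algebraMap k _ c) ≤ 1 ↔ c ∈ 𝒪[k]) ∧
    ∀ P : k[X], P.Monic → Irreducible P → ∃ ρ : ℝ,
      (∀ r : AlgebraicClosure k, aeval r P = 0 → f r = ρ) ∧ (ρ ≤ 1 → ∀ i, P.coeff i ∈ 𝒪[k]) := by
  let := IsTopologicalAddGroup.rightUniformSpace k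
  have := isUniformAddGroup_of_addCommGroup (G := k)
  let : (Valued.v (R := k) (Γ₀ := ValueGroupWithZero k)).RankOne :=
    { hom' := IsRankLeOne.nonempty.some.emb (R := k).comp MonoidWithZeroHom.ValueGroup₀.embedding
      strictMono' := IsRankLeOne.nonempty.some.strictMono.comp
          MonoidWithZeroHom.ValueGroup₀.embedding_strictMono }
  let : NontriviallyNormedField k :=
    Valued.toNontriviallyNormedField k (ValueGroupWithZero k)
  have : IsUltrametricDist k := Valued.instIsUltrametricDist k (ValueGroupWithZero k)
  have : CompleteSpace k := inferInstance
  have hnorm : ∀ c : k, ‖c‖ ≤ 1 ↔ c ∈ 𝒪[k] := fun c =>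
    Valued.toNormedField.norm_le_one_iff (Γ₀ := ValueGroupWithZero k)
  let F := spectralMulAlgNorm k (AlgebraicClosure k)
  refine ⟨⟨⟨F, map_zero F⟩, map_one F, map_mul F⟩, fun y => apply_nonneg F _, fun c => ?_, ?_⟩
  · rw [← hnorm]
    change spectralNorm k (AlgebraicClosure k) (algebraMap k _ c) ≤ 1 ↔ _
    rw [spectralNorm_extends]
  · refine fun P hP hPi => ⟨spectralValue P, fun r hr => ?_, fun h i => ?_⟩
    · change spectralNorm k (AlgebraicClosure k) r = _
      rw [spectralNorm, ← minpoly.eq_of_irreducible_of_monic hPi hr hP]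
    · rw [← hnorm]
      exact (spectralValue_le_one_iff hP).mp h i

variable {k}

/-- The normalized valuation `k → ℤ`, with the junk value `0` at `0`. -/
def val (x : k) : ℤ :=
  -WithZero.log (IsNonarchimedeanLocalField.valueGroupWithZeroIsoInt k (valuation k x))

theorem val_mul {x y : k} (hx : x ≠ 0) (hy : y ≠ 0) : val (x * y) = val x + val y := by
  rw [val, map_mul, map_mul, WithZero.log_mul (by simpa) (by simpa), val, val]
  ring

theorem val_one : val (1 : k) = 0 := by simp [val]

theorem val_inv (x : k) : val x⁻¹ = -val x := by
  simp [val]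

theorem val_pow {x : k} (hx : x ≠ 0) (n : ℕ) : val (x ^ n) = n * val x := by
  induction n with
  | zero => simp [val_one]
  | succ n ih => rw [pow_succ, val_mul (pow_ne_zero _ hx) hx, ih]; push_cast; ring

theorem val_zpow {x : k} (hx : x ≠ 0) (n : ℤ) : val (x ^ n) = n * val x := by
  cases n with
  | ofNat n => simpa using val_pow hx n
  | negSucc n => rw [zpow_negSucc, val_inv, val_pow hx, Int.negSucc_eq]; push_cast; ring

theorem val_prod {ι : Type*} (s : Finset ι) (f : ι → k) (hf : ∀ i ∈ s, f i ≠ 0) :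
    val (∏ i ∈ s, f i) = ∑ i ∈ s, val (f i) := by
  classical
  induction s using Finset.induction_on with
  | empty => simp [val_one]
  | insert a s ha ih =>
    rw [Finset.prod_insert ha, Finset.sum_insert ha, val_mul (hf a (by simp))
      (Finset.prod_ne_zero_iff.mpr fun i hi => hf i (by simp [hi])),
      ih fun i hi => hf i (by simp [hi])]

theorem mem_integer_iff_val {x : k} (hx : x ≠ 0) : x ∈ 𝒪[k] ↔ 0 ≤ val x := by
  have h : x ∈ 𝒪[k] ↔ valuation k x ≤ 1 := Iff.rfl
  rw [h, val, neg_nonneg, ← WithZero.log_one, WithZero.log_le_log (by simpa) one_ne_zero,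
    ← map_one (IsNonarchimedeanLocalField.valueGroupWithZeroIsoInt k),
    map_le_map_iff]

variable (k) in
theorem exists_val_eq_one : ∃ p : k, p ≠ 0 ∧ val p = 1 := by
  obtain ⟨g, hg⟩ := (IsNonarchimedeanLocalField.valueGroupWithZeroIsoInt k).surjective
    (WithZero.exp (-1))
  obtain ⟨p, rfl⟩ := valuation_surjective g
  refine ⟨p, ?_, ?_⟩
  · rintro rfl
    simp at hg
    exact WithZero.exp_ne_zero hg.symm
  · rw [val, show IsNonarchimedeanLocalField.valueGroupWithZeroIsoInt k (valuation k p) = _ from hg,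
      WithZero.log_exp, neg_neg]

theorem mem_powMulUnits_iff {d : ℕ} {y : k} :
    y ∈ powMulUnits k d ↔ y ≠ 0 ∧ (d : ℤ) ∣ val y := by
  constructor
  · rintro ⟨a, u, rfl⟩
    have hu : ((u : 𝒪[k]) : k) ≠ 0 := by simp
    have ha : (a : k) ≠ 0 := a.ne_zero
    refine ⟨mul_ne_zero (pow_ne_zero _ ha) hu, ?_⟩
    have h1 := (mem_integer_iff_val hu).mp (u : 𝒪[k]).2
    have hm : ((u : 𝒪[k]) : k) * ((u⁻¹ : (𝒪[k])ˣ) : 𝒪[k]) = 1 := by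
      rw [← Subring.coe_mul, Units.mul_inv, Subring.coe_one]
    have hu' : (((u⁻¹ : (𝒪[k])ˣ) : 𝒪[k]) : k) ≠ 0 := by simp
    have h2 := (mem_integer_iff_val hu').mp ((u⁻¹ : (𝒪[k])ˣ) : 𝒪[k]).2
    have h3 := val_mul hu hu'
    rw [hm, val_one] at h3
    have h4 : val ((u : 𝒪[k]) : k) = 0 := by omega
    rw [val_mul (pow_ne_zero _ ha) hu, val_pow ha, h4, add_zero]
    exact dvd_mul_right _ _
  · rintro ⟨hy, c, hc⟩
    obtain ⟨p, hp, hp1⟩ := exists_val_eq_one k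
    have ha : p ^ c ≠ 0 := zpow_ne_zero _ hp
    set w := y * ((p ^ c) ^ d)⁻¹ with hw
    have hw0 : w ≠ 0 := mul_ne_zero hy (inv_ne_zero (pow_ne_zero _ ha))
    have hwv : val w = 0 := by
      rw [hw, val_mul hy (inv_ne_zero (pow_ne_zero _ ha)), val_inv, val_pow ha, val_zpow hp, hp1,
        hc]
      ring
    refine ⟨Units.mk0 _ ha, ⟨⟨w, (mem_integer_iff_val hw0).mpr hwv.ge⟩,
      ⟨w⁻¹, (mem_integer_iff_val (inv_ne_zero hw0)).mpr (by rw [val_inv, hwv]; rfl)⟩, ?_, ?_⟩, ?_⟩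
    · ext; simp [hw0]
    · ext; simp [hw0]
    · simp only [Units.val_mk0, hw]
      field_simp

/-- An element of a division algebra over a local field is integral if and only if its reduced
norm is: the reduced norm is a product of conjugates, which all have the same absolute value. -/
theorem isIntegral_iff_reducedNorm_mem [CharZero k] {D : Type*} [DivisionRing D] [Algebra k D]
    [FiniteDimensional k D] {m : ℕ}
    (φ : (AlgebraicClosure k ⊗[k] D) ≃ₐ[AlgebraicClosure k]
      Matrix (Fin m) (Fin m) (AlgebraicClosure k)) (hm : m ≠ 0) (x : D) :
    IsIntegral 𝒪[k] x ↔ reducedNorm k x ∈ 𝒪[k] := by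
  constructor
  · intro h
    obtain ⟨y, hy⟩ := IsIntegrallyClosed.isIntegral_iff.mp (isIntegral_reducedNorm φ h)
    exact hy ▸ y.2
  intro h
  obtain ⟨f, hf0, hf1, hf⟩ := exists_spectral_absoluteValue k
  have hint : IsIntegral k x := Algebra.IsIntegral.isIntegral x
  obtain ⟨ρ, hρ, hρP⟩ := hf (minpoly k x) (minpoly.monic hint) (minpoly.irreducible hint)
  have hdet : f (algebraMap k _ (reducedNorm k x)) = ρ ^ m := by
    rw [algebraMap_reducedNorm φ, Matrix.det_eq_prod_roots_charpoly, map_multiset_prod,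
      Multiset.eq_replicate_of_mem (a := ρ) (s := Multiset.map f _), Multiset.prod_replicate,
      Multiset.card_map, IsAlgClosed.card_roots_eq_natDegree, Matrix.charpoly_natDegree_eq_dim,
      Fintype.card_fin]
    intro b hb
    obtain ⟨r, hr, rfl⟩ := Multiset.mem_map.mp hb
    exact hρ r (eval_eq_zero_of_mem_roots_charpoly φ (minpoly.aeval k x) hr)
  have hρ0 : 0 ≤ ρ := by
    obtain ⟨r, hr⟩ := IsAlgClosed.exists_aeval_eq_zero (AlgebraicClosure k) (minpoly k x)
      (minpoly.degree_pos hint).ne'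
    exact hρ r hr ▸ hf0 r
  have h1 : ρ ≤ 1 := by
    rw [← hf1, hdet] at h
    exact (pow_le_one_iff_of_nonneg hρ0 hm).mp h
  have h2 : minpoly k x ∈ lifts (algebraMap 𝒪[k] k) := by
    rw [lifts_iff_coeff_lifts]
    exact fun i => ⟨⟨_, hρP h1 i⟩, rfl⟩
  obtain ⟨Q, hQ, -, hQm⟩ := lifts_and_natDegree_eq_and_monic h2 (minpoly.monic hint)
  refine ⟨Q, hQm, ?_⟩
  have := minpoly.aeval k x
  rwa [← hQ, aeval_map_algebraMap] at this

end LocalField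

/-! ### The valuation and the residue ring of a division algebra -/

section DivisionAlgebra

open Polynomial ValuativeRel

variable {k : Type*} [Field k] [CharZero k]
  {D : Type*} [DivisionRing D] [Algebra k D] [Algebra.IsCentral k D] [FiniteDimensional k D]

variable (k) in
theorem reducedNorm_mul_of_divisionRing (x y : D) :
    reducedNorm k (x * y) = reducedNorm k x * reducedNorm k y := by
  obtain ⟨m, -, -, ⟨φ⟩⟩ := exists_splitting (k := k) D
  exact reducedNorm_mul φ x y

variable (k D) in
theorem reducedNorm_one_of_divisionRing : reducedNorm k (1 : D) = 1 := by
  obtain ⟨m, -, -, ⟨φ⟩⟩ := exists_splitting (k := k) D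
  exact reducedNorm_one φ

variable (k) in
theorem reducedNorm_ne_zero {x : D} (hx : x ≠ 0) : reducedNorm k x ≠ 0 := by
  intro h
  have := reducedNorm_mul_of_divisionRing k x x⁻¹
  rw [mul_inv_cancel₀ hx, reducedNorm_one_of_divisionRing, h, zero_mul] at this
  exact one_ne_zero this

variable [ValuativeRel k] [TopologicalSpace k] [IsNonarchimedeanLocalField k]

variable (k) in
/-- The valuation of the reduced norm of an element of `D`, with the junk value `0` at `0`. It is
the normalized valuation of `D`, see `ord_prime`. -/
def ord (x : D) : ℤ := val (reducedNorm k x)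

theorem ord_mul {x y : D} (hx : x ≠ 0) (hy : y ≠ 0) : ord k (x * y) = ord k x + ord k y := by
  rw [ord, reducedNorm_mul_of_divisionRing,
    val_mul (reducedNorm_ne_zero k hx) (reducedNorm_ne_zero k hy), ord, ord]

variable (k D) in
theorem ord_one : ord k (1 : D) = 0 := by
  rw [ord, reducedNorm_one_of_divisionRing, val_one]

theorem ord_inv (x : D) : ord k x⁻¹ = -ord k x := by
  by_cases hx : x = 0
  · subst hx
    have : reducedNorm k (0 : D) = 0 := by
      obtain ⟨m, hm, -, ⟨φ⟩⟩ := exists_splitting (k := k) D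
      simpa [hm] using reducedNorm_algebraMap φ 0
    simp [ord, this, val]
  · have h := ord_mul (k := k) hx (inv_ne_zero hx)
    rw [mul_inv_cancel₀ hx, ord_one] at h
    omega

theorem ord_units_zpow (u : Dˣ) (a : ℤ) : ord k ((u ^ a : Dˣ) : D) = a * ord k (u : D) := by
  have h : ∀ n : ℕ, ord k ((u ^ n : Dˣ) : D) = n * ord k (u : D) := fun n => by
    induction n with
    | zero => simp [ord_one]
    | succ n ih =>
      rw [pow_succ, Units.val_mul, ord_mul (Units.ne_zero _) (Units.ne_zero _), ih]
      push_cast; ring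
  cases a with
  | ofNat n => simpa using h n
  | negSucc n =>
    rw [zpow_negSucc, Units.val_inv_eq_inv_val, ord_inv, h, Int.negSucc_eq]
    push_cast; ring

theorem mem_maxOrder_iff {x : D} : x ∈ maxOrder k D ↔ x = 0 ∨ 0 ≤ ord k x := by
  by_cases hx : x = 0
  · subst hx
    simp [maxOrder, isIntegral_zero]
  obtain ⟨m, hm, -, ⟨φ⟩⟩ := exists_splitting (k := k) D
  rw [maxOrder, Set.mem_ofPred_eq, isIntegral_iff_reducedNorm_mem φ hm,
    mem_integer_iff_val (reducedNorm_ne_zero k hx), ord]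
  simp [hx]

theorem isIntegral_add_one {R B : Type*} [CommRing R] [Ring B] [Algebra R B] {x : B}
    (hx : IsIntegral R x) : IsIntegral R (x + 1) := by
  obtain ⟨P, hP, hPx⟩ := hx
  nontriviality R
  refine ⟨P.comp (X - C 1), hP.comp (monic_X_sub_C 1)
    (by rw [natDegree_X_sub_C]; exact one_ne_zero), ?_⟩
  change aeval (x + 1) (P.comp (X - C 1)) = 0
  rw [aeval_comp]
  rw [map_sub, aeval_X, aeval_C, map_one, add_sub_cancel_right]
  exact hPx

/-- The ultrametric inequality for `ord`: it reduces to the fact that `z + 1` is integral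
if `z` is. -/
theorem ord_add {x y : D} {a : ℤ} (hx : x = 0 ∨ a ≤ ord k x) (hy : y = 0 ∨ a ≤ ord k y) :
    x + y = 0 ∨ a ≤ ord k (x + y) := by
  have key : ∀ {x y : D}, x ≠ 0 → y ≠ 0 → ord k y ≤ ord k x →
      x + y = 0 ∨ ord k y ≤ ord k (x + y) := by
    intro x y hx hy hxy
    have h1 : x * y⁻¹ ∈ maxOrder k D := by
      rw [mem_maxOrder_iff, ord_mul hx (inv_ne_zero hy), ord_inv]
      right; omega
    have h2 : x * y⁻¹ + 1 ∈ maxOrder k D := isIntegral_add_one h1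
    have h3 : x + y = (x * y⁻¹ + 1) * y := by
      rw [add_mul, mul_assoc, inv_mul_cancel₀ hy, mul_one, one_mul]
    by_cases h4 : x * y⁻¹ + 1 = 0
    · left; rw [h3, h4, zero_mul]
    · right
      rw [h3, ord_mul h4 hy]
      have := (mem_maxOrder_iff.mp h2).resolve_left h4
      omega
  by_cases hx0 : x = 0
  · simpa [hx0] using hy
  by_cases hy0 : y = 0
  · simpa [hy0] using hx
  have hx := hx.resolve_left hx0
  have hy := hy.resolve_left hy0
  rcases le_total (ord k y) (ord k x) with h | h
  · exact (key hx0 hy0 h).imp_right fun h' => hy.trans h'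
  · rw [add_comm]
    exact (key hy0 hx0 h).imp_right fun h' => hx.trans h'

theorem ord_mul_le {x y : D} {a b : ℤ} (hx : x = 0 ∨ a ≤ ord k x) (hy : y = 0 ∨ b ≤ ord k y) :
    x * y = 0 ∨ a + b ≤ ord k (x * y) := by
  by_cases hx0 : x = 0
  · simp [hx0]
  by_cases hy0 : y = 0
  · simp [hy0]
  right
  rw [ord_mul hx0 hy0]
  have hx := hx.resolve_left hx0
  have hy := hy.resolve_left hy0
  omega

omit [Algebra.IsCentral k D] [FiniteDimensional k D] in
theorem ord_algebraMap {m : ℕ} (φ : (AlgebraicClosure k ⊗[k] D) ≃ₐ[AlgebraicClosure k]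
      Matrix (Fin m) (Fin m) (AlgebraicClosure k)) {c : k} (hc : c ≠ 0) :
    ord k (algebraMap k D c) = m * val c := by
  rw [ord, reducedNorm_algebraMap φ, val_pow hc]

variable (k D) in
/-- The maximal order `Δ` of `D` as a subalgebra. -/
def maxOrderSubalgebra : Subalgebra 𝒪[k] D where
  carrier := maxOrder k D
  mul_mem' hx hy := by
    rw [mem_maxOrder_iff] at hx hy ⊢
    simpa using ord_mul_le hx hy
  add_mem' hx hy := by
    rw [mem_maxOrder_iff] at hx hy ⊢
    exact ord_add hx hy
  algebraMap_mem' r := isIntegral_algebraMap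

theorem mem_maxOrderSubalgebra {x : D} :
    x ∈ maxOrderSubalgebra k D ↔ x = 0 ∨ 0 ≤ ord k x := mem_maxOrder_iff

variable (k D) in
/-- The maximal ideal `𝔭` of `Δ`. -/
def primeIdeal : Ideal (maxOrderSubalgebra k D) where
  carrier := {x | (x : D) = 0 ∨ 1 ≤ ord k (x : D)}
  add_mem' hx hy := ord_add hx hy
  zero_mem' := Or.inl rfl
  smul_mem' c x hx := by
    have := ord_mul_le (mem_maxOrderSubalgebra.mp c.2) hx
    simpa using this

theorem mem_primeIdeal {x : maxOrderSubalgebra k D} :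
    x ∈ primeIdeal k D ↔ (x : D) = 0 ∨ 1 ≤ ord k (x : D) := Iff.rfl

instance : (primeIdeal k D).IsTwoSided where
  mul_mem_of_left {x} y hx := by
    have := ord_mul_le (mem_primeIdeal.mp hx) (mem_maxOrderSubalgebra.mp y.2)
    rw [mem_primeIdeal]
    simpa using this

variable (k D) in
/-- The residue division ring `Δ / 𝔭` of `D`. -/
def ResidueRing : Type _ := maxOrderSubalgebra k D ⧸ primeIdeal k D

instance : Ring (ResidueRing k D) :=
  inferInstanceAs (Ring (maxOrderSubalgebra k D ⧸ primeIdeal k D))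

variable (k D) in
/-- The reduction map `Δ → Δ / 𝔭`. -/
def residue : maxOrderSubalgebra k D →+* ResidueRing k D := Ideal.Quotient.mk (primeIdeal k D)

theorem residue_surjective : Function.Surjective (residue k D) := Ideal.Quotient.mk_surjective

theorem residue_eq_zero_iff {x : maxOrderSubalgebra k D} :
    residue k D x = 0 ↔ (x : D) = 0 ∨ 1 ≤ ord k (x : D) :=
  Ideal.Quotient.eq_zero_iff_mem.trans mem_primeIdeal

instance : Nontrivial (ResidueRing k D) := by
  refine Ideal.Quotient.nontrivial_iff.mpr fun h => ?_
  have h1 : (1 : maxOrderSubalgebra k D) ∈ primeIdeal k D := h ▸ trivial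
  rw [mem_primeIdeal] at h1
  simp [ord_one] at h1

theorem isUnit_of_ord_eq_zero {x : maxOrderSubalgebra k D} (hx : (x : D) ≠ 0)
    (h : ord k (x : D) = 0) : IsUnit x := by
  have h3 : ((x : D))⁻¹ ∈ maxOrderSubalgebra k D := by
    rw [mem_maxOrderSubalgebra, ord_inv]
    right; omega
  exact ⟨⟨x, ⟨_, h3⟩, Subtype.ext (mul_inv_cancel₀ hx), Subtype.ext (inv_mul_cancel₀ hx)⟩, rfl⟩

theorem isUnit_residueRing {a : ResidueRing k D} (ha : a ≠ 0) : IsUnit a := by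
  obtain ⟨x, rfl⟩ := residue_surjective a
  rw [ne_eq, residue_eq_zero_iff, not_or] at ha
  have h2 := (mem_maxOrderSubalgebra.mp x.2).resolve_left ha.1
  exact (isUnit_of_ord_eq_zero ha.1 (by omega)).map _

end DivisionAlgebra

/-! ### Finiteness and commutativity of the residue ring -/

theorem isPrecomplete_pi {R ι : Type*} [CommRing R] [Finite ι] (I : Ideal R) [IsPrecomplete I R] :
    IsPrecomplete I (ι → R) := by
  classical
  have := Fintype.ofFinite ι
  have h1 : ∀ (n : ℕ) (v : ι → R), v ∈ (I ^ n • ⊤ : Submodule R (ι → R)) ↔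
      ∀ i, v i ∈ (I ^ n • ⊤ : Submodule R R) := by
    intro n v
    constructor
    · intro hv i
      have := Submodule.mem_map_of_mem (f := LinearMap.proj (R := R) (φ := fun _ : ι => R) i) hv
      rw [Submodule.map_smul''] at this
      exact Submodule.smul_mono le_rfl le_top this
    · intro hv
      have : v = ∑ i, v i • (Pi.single i 1 : ι → R) := by
        ext j
        simp [Finset.sum_apply, Pi.single_apply]
      rw [this]
      refine Submodule.sum_mem _ fun i _ => Submodule.smul_mem_smul ?_ trivial
      simpa using hv i
  refine ⟨fun f hf => ?_⟩
  have h2 : ∀ i, ∃ L : R, ∀ n, f n i ≡ L [SMOD (I ^ n • ⊤ : Submodule R R)] := fun i =>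
    IsPrecomplete.prec' (fun n => f n i) fun {a b} hab => by
      have := hf hab
      rw [SModEq.sub_mem, h1] at this
      rw [SModEq.sub_mem]
      exact this i
  choose L hL using h2
  refine ⟨L, fun n => ?_⟩
  rw [SModEq.sub_mem, h1]
  exact fun i => SModEq.sub_mem.mp (hL i n)

theorem finite_of_forall_card_le {K V : Type*} [DivisionRing K] [AddCommGroup V] [Module K V]
    {n : ℕ} (h : ∀ s : Finset V, LinearIndependent K (fun i : s => (i : V)) → s.card ≤ n) :
    Module.Finite K V := by
  rw [← Module.rank_lt_aleph0_iff]
  exact lt_of_le_of_lt (rank_le h) Cardinal.natCast_lt_aleph0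

section DivisionAlgebra

open Polynomial ValuativeRel

variable {k : Type*} [Field k] [CharZero k]
  {D : Type*} [DivisionRing D] [Algebra k D] [Algebra.IsCentral k D] [FiniteDimensional k D]
  [ValuativeRel k] [TopologicalSpace k] [IsNonarchimedeanLocalField k]

omit [CharZero k] in
theorem mem_maximalIdeal_iff {x : 𝒪[k]} :
    x ∈ 𝓂[k] ↔ (x : k) = 0 ∨ 1 ≤ val (x : k) := by
  rw [IsLocalRing.mem_maximalIdeal, mem_nonunits_iff]
  by_cases hx : (x : k) = 0
  · have : x = 0 := Subtype.ext hx
    simp [this]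
  have h0 := (mem_integer_iff_val hx).mp x.2
  simp only [hx, false_or]
  constructor
  · intro h
    by_contra h1
    have h2 : (x : k)⁻¹ ∈ 𝒪[k] := by
      rw [mem_integer_iff_val (inv_ne_zero hx), val_inv]
      omega
    exact h (IsUnit.of_mul_eq_one ⟨_, h2⟩ (Subtype.ext (mul_inv_cancel₀ hx)))
  · rintro h ⟨u, rfl⟩
    have hm : ((u : 𝒪[k]) : k) * ((u⁻¹ : (𝒪[k])ˣ) : 𝒪[k]) = 1 := by
      rw [← Subring.coe_mul, Units.mul_inv, Subring.coe_one]
    have hu' : (((u⁻¹ : (𝒪[k])ˣ) : 𝒪[k]) : k) ≠ 0 := by simp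
    have h2 := (mem_integer_iff_val hu').mp ((u⁻¹ : (𝒪[k])ˣ) : 𝒪[k]).2
    have h3 := val_mul hx hu'
    rw [hm, val_one] at h3
    omega

theorem algebraMap_mem_primeIdeal {x : 𝒪[k]} (hx : x ∈ 𝓂[k]) :
    algebraMap 𝒪[k] (maxOrderSubalgebra k D) x ∈ primeIdeal k D := by
  obtain ⟨m, hm, -, ⟨φ⟩⟩ := exists_splitting (k := k) D
  rw [mem_primeIdeal]
  change algebraMap k D (x : k) = 0 ∨ 1 ≤ ord k (algebraMap k D (x : k))
  by_cases h0 : (x : k) = 0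
  · simp [h0]
  right
  rw [ord_algebraMap φ h0]
  have h1 := (mem_maximalIdeal_iff.mp hx).resolve_left h0
  have : 1 ≤ (m : ℤ) := by exact_mod_cast Nat.one_le_iff_ne_zero.mpr hm
  nlinarith

variable (k D) in
/-- The embedding of the residue field of `k` into the residue division ring of `D`. -/
def residueMap : 𝓀[k] →+* ResidueRing k D :=
  Ideal.Quotient.lift 𝓂[k]
    ((residue k D).comp (algebraMap 𝒪[k] (maxOrderSubalgebra k D)))
    fun _ hx => Ideal.Quotient.eq_zero_iff_mem.mpr (algebraMap_mem_primeIdeal hx)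

theorem residueMap_residue (x : 𝒪[k]) : residueMap k D (IsLocalRing.residue 𝒪[k] x) =
    residue k D (algebraMap 𝒪[k] (maxOrderSubalgebra k D) x) := rfl

instance : Algebra 𝓀[k] (ResidueRing k D) := (residueMap k D).toAlgebra' fun c x => by
  obtain ⟨c, rfl⟩ := IsLocalRing.residue_surjective c
  obtain ⟨x, rfl⟩ := residue_surjective x
  rw [residueMap_residue, ← map_mul, ← map_mul, Algebra.commutes]

theorem residue_smul_residue (c : 𝒪[k]) (x : maxOrderSubalgebra k D) :
    IsLocalRing.residue 𝒪[k] c • residue k D x =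
      residue k D (c • x) := by
  rw [Algebra.smul_def, Algebra.smul_def, map_mul]
  rfl

/-- Lifts of elements that are linearly independent over the residue field are linearly
independent over `k`. -/
theorem linearIndependent_of_residue {ι : Type*} [Fintype ι] (b : ι → maxOrderSubalgebra k D)
    (hb : LinearIndependent 𝓀[k] fun i => residue k D (b i)) :
    LinearIndependent k fun i => (b i : D) := by
  classical
  rw [Fintype.linearIndependent_iff] at hb ⊢
  intro c hc
  by_contra! hne
  obtain ⟨i1, hi1⟩ := hne
  obtain ⟨i0, hi0, hmin⟩ := Finset.exists_min_image (Finset.univ.filter fun i => c i ≠ 0)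
    (fun i => val (c i)) ⟨i1, by simpa using hi1⟩
  have hi0 : c i0 ≠ 0 := by simpa using hi0
  have hd : ∀ i, c i * (c i0)⁻¹ ∈ 𝒪[k] := by
    intro i
    by_cases h : c i = 0
    · rw [h, zero_mul]; exact zero_mem _
    · rw [mem_integer_iff_val (mul_ne_zero h (inv_ne_zero hi0)), val_mul h (inv_ne_zero hi0),
        val_inv]
      have := hmin i (by simpa using h)
      omega
  let d : ι → 𝒪[k] := fun i => ⟨_, hd i⟩
  have h1 : ∑ i, d i • b i = 0 := by
    apply Subtype.ext
    have : ∑ i, (c i0)⁻¹ • c i • (b i : D) = 0 := by rw [← Finset.smul_sum, hc, smul_zero]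
    rw [AddSubmonoidClass.coe_finsetSum, ZeroMemClass.coe_zero, ← this]
    refine Finset.sum_congr rfl fun i _ => ?_
    rw [smul_smul, mul_comm]
    rfl
  have h2 := hb (fun i => IsLocalRing.residue 𝒪[k] (d i)) (by
    simp_rw [residue_smul_residue]
    rw [← map_sum, h1, map_zero]) i0
  have h3 : d i0 = 1 := Subtype.ext (mul_inv_cancel₀ hi0)
  rw [h3, map_one] at h2
  exact one_ne_zero h2

instance : Module.Finite 𝓀[k] (ResidueRing k D) := by
  refine finite_of_forall_card_le (n := Module.finrank k D) fun s hs => ?_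
  choose b hb using fun x : ResidueRing k D => residue_surjective x
  have h := linearIndependent_of_residue (k := k) (D := D) (fun i : s => b i)
    (by simpa only [hb] using hs)
  have h2 := h.fintype_card_le_finrank
  rwa [Fintype.card_coe] at h2

instance : Finite (ResidueRing k D) := Module.finite_of_finite 𝓀[k]

/-- By Wedderburn's little theorem the residue division ring of `D` is a finite field. -/
instance : Field (ResidueRing k D) :=
  { (inferInstance : Ring (ResidueRing k D)) with
    mul_comm := fun a b => by
      let h : DivisionRing (ResidueRing k D) :=
        DivisionRing.ofIsUnitOrEqZero fun a => (em (a = 0)).symm.imp isUnit_residueRing id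
      exact (littleWedderburn (ResidueRing k D)).mul_comm a b
    inv := Ring.inverse
    mul_inv_cancel := fun a ha => Ring.mul_inverse_cancel a (isUnit_residueRing ha)
    inv_zero := Ring.inverse_zero _
    exists_pair_ne := exists_pair_ne _
    nnqsmul := _
    nnqsmul_def := fun _ _ => rfl
    qsmul := _
    qsmul_def := fun _ _ => rfl }

end DivisionAlgebra

/-! ### Ramification index and residue degree -/

section DivisionAlgebra

open Polynomial ValuativeRel

variable {k : Type*} [Field k] [CharZero k]
  {D : Type*} [DivisionRing D] [Algebra k D] [Algebra.IsCentral k D] [FiniteDimensional k D]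
  [ValuativeRel k] [TopologicalSpace k] [IsNonarchimedeanLocalField k]

theorem residue_aeval (x : maxOrderSubalgebra k D) (Q : 𝒪[k][X]) :
    residue k D (aeval x Q) = aeval (residue k D x) (Q.map (IsLocalRing.residue 𝒪[k])) := by
  induction Q using Polynomial.induction_on' with
  | add p q hp hq => simp [hp, hq]
  | monomial i a =>
    rw [map_monomial, aeval_monomial, aeval_monomial, map_mul, map_pow]
    rfl

omit [CharZero k] [Algebra.IsCentral k D] [TopologicalSpace k]
  [IsNonarchimedeanLocalField k] in
theorem exists_map_eq_minpoly {x : D} (hx : IsIntegral 𝒪[k] x) :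
    ∃ Q : 𝒪[k][X], Q.Monic ∧ Q.map (algebraMap 𝒪[k] k) = minpoly k x ∧ aeval x Q = 0 := by
  obtain ⟨P, hP, hPx⟩ := hx
  have h1 : minpoly k x ∣ P.map (algebraMap 𝒪[k] k) := by
    apply minpoly.dvd
    rw [aeval_map_algebraMap]
    exact hPx
  obtain ⟨Q, hQ⟩ := IsIntegrallyClosed.eq_map_mul_C_of_dvd k hP h1
  have hm : (minpoly k x).Monic := minpoly.monic (Algebra.IsIntegral.isIntegral x)
  rw [hm.leadingCoeff, C_1, mul_one] at hQ
  refine ⟨Q, ?_, hQ, ?_⟩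
  · exact (IsFractionRing.injective 𝒪[k] k).monic_map_iff.mpr (hQ ▸ hm)
  · rw [← aeval_map_algebraMap k, hQ, minpoly.aeval]

section Prime

variable {ϖ : Dˣ}

/-- A preliminary form of `mem_primePow_iff`, in which `ord ϖ` is not known to be `1` yet. -/
theorem mem_primePow_iff_mul {a : ℤ} {x : D} :
    x ∈ primePow k ϖ a ↔ x = 0 ∨ a * ord k (ϖ : D) ≤ ord k x := by
  rw [primePow, Set.mem_ofPred_eq, mem_maxOrder_iff]
  by_cases hx : x = 0
  · simp [hx]
  · rw [ord_mul (Units.ne_zero _) hx, ord_units_zpow, mul_eq_zero]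
    simp only [hx, Units.ne_zero, or_self, false_or]
    constructor <;> intro h <;> linarith

theorem ord_prime_pos (hϖ : IsPrimeElement k ϖ) : 0 < ord k (ϖ : D) := by
  have h1 := (hϖ ϖ).mp (mem_primePow_iff_mul.mpr (Or.inr (by simp)))
  have h2 := (mem_maxOrder_iff.mp h1.1).resolve_left (Units.ne_zero _)
  by_contra h3
  refine h1.2 ⟨Units.ne_zero _, mem_maxOrder_iff.mpr (Or.inr ?_)⟩
  rw [ord_inv]
  omega

theorem ord_prime_le (hϖ : IsPrimeElement k ϖ) {x : D} (hx : x ≠ 0) (h : 0 < ord k x) :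
    ord k (ϖ : D) ≤ ord k x := by
  have h1 : x ∈ primePow k ϖ 1 := by
    refine (hϖ x).mpr ⟨mem_maxOrder_iff.mpr (Or.inr h.le), fun h2 => ?_⟩
    have := (mem_maxOrder_iff.mp h2.2).resolve_left (inv_ne_zero hx)
    rw [ord_inv] at this
    omega
  simpa [hx] using mem_primePow_iff_mul.mp h1

/-- Every order is a multiple of `ord ϖ`, because the remainder of a division by `ord ϖ` is
the order of some element and `ord ϖ` is the least positive order. -/
theorem ord_prime_dvd (hϖ : IsPrimeElement k ϖ) {x : D} (hx : x ≠ 0) :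
    ord k (ϖ : D) ∣ ord k x := by
  have hpos := ord_prime_pos hϖ
  have h1 : ord k (x * ((ϖ ^ (-(ord k x / ord k (ϖ : D))) : Dˣ) : D)) =
      ord k x % ord k (ϖ : D) := by
    rw [ord_mul hx (Units.ne_zero _), ord_units_zpow, Int.emod_def]
    ring
  by_contra h2
  have h3 := Int.emod_nonneg (ord k x) hpos.ne'
  have h4 := Int.emod_lt_of_pos (ord k x) hpos
  have h5 : ord k x % ord k (ϖ : D) ≠ 0 := fun h => h2 (Int.dvd_of_emod_eq_zero h)
  have h6 := ord_prime_le hϖ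
    (mul_ne_zero hx (Units.ne_zero (ϖ ^ (-(ord k x / ord k (ϖ : D)))))) (by omega)
  omega

/-- `ϖ` as an element of `Δ`. -/
def primeElement (hϖ : IsPrimeElement k ϖ) : maxOrderSubalgebra k D :=
  ⟨ϖ, mem_maxOrderSubalgebra.mpr (Or.inr (ord_prime_pos hϖ).le)⟩

theorem exists_eq_mul_pow (hϖ : IsPrimeElement k ϖ) {x : maxOrderSubalgebra k D} {t : ℕ}
    (hx : (x : D) = 0 ∨ t * ord k (ϖ : D) ≤ ord k (x : D)) :
    ∃ y : maxOrderSubalgebra k D, x = y * primeElement hϖ ^ t := by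
  refine ⟨⟨x * ((ϖ ^ (-(t : ℤ)) : Dˣ) : D), ?_⟩, ?_⟩
  · rw [mem_maxOrderSubalgebra]
    by_cases h0 : (x : D) = 0
    · simp [h0]
    · rw [ord_mul h0 (Units.ne_zero _), ord_units_zpow]
      have := hx.resolve_left h0
      right; linarith
  · apply Subtype.ext
    change (x : D) = x * ((ϖ ^ (-(t : ℤ)) : Dˣ) : D) * (ϖ : D) ^ t
    rw [mul_assoc, ← Units.val_pow_eq_pow_val, ← Units.val_mul]
    simp

theorem coe_smul_maxOrder (r : 𝒪[k]) (y : maxOrderSubalgebra k D) :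
    ((r • y : maxOrderSubalgebra k D) : D) = algebraMap k D (r : k) * (y : D) :=
  Algebra.smul_def (r : k) (y : D)

theorem isHausdorff_maxOrder : IsHausdorff 𝓂[k] (maxOrderSubalgebra k D) := by
  have h2 : ∀ (n : ℕ) (x : maxOrderSubalgebra k D),
      x ∈ (𝓂[k] ^ n • ⊤ : Submodule 𝒪[k] (maxOrderSubalgebra k D)) →
        (x : D) = 0 ∨ (n : ℤ) ≤ ord k (x : D) := by
    intro n
    induction n with
    | zero => exact fun x _ => by simpa using mem_maxOrderSubalgebra.mp x.2
    | succ n ih =>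
      intro x hx
      rw [pow_succ', mul_smul] at hx
      refine Submodule.smul_induction_on hx (fun r hr y hy => ?_) fun x y hx hy => ord_add hx hy
      rw [coe_smul_maxOrder]
      have := ord_mul_le (mem_primeIdeal.mp (algebraMap_mem_primeIdeal (D := D) hr)) (ih y hy)
      push_cast
      rwa [add_comm (n : ℤ)]
  refine ⟨fun x hx => ?_⟩
  by_contra h0
  have h0' : (x : D) ≠ 0 := fun h => h0 (Subtype.ext h)
  have h3 := h2 ((ord k (x : D)).toNat + 1) x (by simpa [SModEq.zero] using hx _)
  have := h3.resolve_left h0'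
  omega

end Prime

end DivisionAlgebra

section DivisionAlgebra

open Polynomial ValuativeRel

variable {k : Type*} [Field k] [CharZero k]
  {D : Type*} [DivisionRing D] [Algebra k D] [Algebra.IsCentral k D] [FiniteDimensional k D]
  [ValuativeRel k] [TopologicalSpace k] [IsNonarchimedeanLocalField k]

variable {ϖ : Dˣ}

/-- The expansion of an element of `Δ` in powers of `ϖ`, with digits in the `R`-span of the powers of
a lift `g` of a generator of the residue field, up to the term of index `t`. -/
theorem exists_expansion (hϖ : IsPrimeElement k ϖ) {r : ℕ} {g : maxOrderSubalgebra k D}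
    (hg : ∀ x : maxOrderSubalgebra k D, ∃ c : Fin r → 𝒪[k],
      residue k D (x - ∑ i, c i • g ^ (i : ℕ)) = 0) (t : ℕ) (x : maxOrderSubalgebra k D) :
    ∃ (c : Fin t → Fin r → 𝒪[k]) (y : maxOrderSubalgebra k D),
      x = (∑ j, ∑ i, c j i • (g ^ (i : ℕ) * primeElement hϖ ^ (j : ℕ))) +
        y * primeElement hϖ ^ t := by
  induction t with
  | zero => exact ⟨0, x, by simp⟩
  | succ t ih =>
    obtain ⟨c, y, hy⟩ := ih
    obtain ⟨c', hc'⟩ := hg y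
    rw [residue_eq_zero_iff] at hc'
    obtain ⟨z, hz⟩ := exists_eq_mul_pow hϖ (t := 1) (x := y - ∑ i, c' i • g ^ (i : ℕ))
      (by
        rw [or_iff_not_imp_left] at hc' ⊢
        exact fun h0 => by simpa using ord_prime_le hϖ h0 (hc' h0))
    refine ⟨Fin.snoc c c', z, ?_⟩
    rw [Fin.sum_univ_castSucc]
    simp only [Fin.snoc_castSucc, Fin.snoc_last, Fin.val_castSucc, Fin.val_last]
    rw [sub_eq_iff_eq_add] at hz
    rw [hy, add_assoc]
    congr 1
    nth_rewrite 1 [hz]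
    rw [pow_one, add_mul, mul_assoc, ← pow_succ', add_comm, Finset.sum_mul]
    congr 1
    exact Finset.sum_congr rfl fun i _ => smul_mul_assoc _ _ _

/-- The products `g ^ i ϖ ^ j` with `i < r` and `j < e`, where `p` has order `e` in units of `ord ϖ`,
generate `Δ` over `R` modulo `p`, hence generate `Δ` by completeness. -/
theorem finrank_le_mul (hϖ : IsPrimeElement k ϖ) {r : ℕ} {g : maxOrderSubalgebra k D}
    (hg : ∀ x : maxOrderSubalgebra k D, ∃ c : Fin r → 𝒪[k],
      residue k D (x - ∑ i, c i • g ^ (i : ℕ)) = 0) {p : k} (hp0 : p ≠ 0) (hp1 : val p = 1)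
    {e : ℕ} (he : ord k (algebraMap k D p) = e * ord k (ϖ : D)) :
    Module.finrank k D ≤ e * r := by
  let v : Fin e × Fin r → maxOrderSubalgebra k D := fun a =>
    g ^ (a.2 : ℕ) * primeElement hϖ ^ (a.1 : ℕ)
  let f : (Fin e × Fin r → 𝒪[k]) →ₗ[𝒪[k]] maxOrderSubalgebra k D := Fintype.linearCombination _ v
  have hpR : p ∈ 𝒪[k] := (mem_integer_iff_val hp0).mpr (by omega)
  have hpm : (⟨p, hpR⟩ : 𝒪[k]) ∈ 𝓂[k] := mem_maximalIdeal_iff.mpr (Or.inr hp1.ge)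
  have hpD : algebraMap k D p ≠ 0 := by simpa using hp0
  let := IsTopologicalAddGroup.rightUniformSpace k
  have := isUniformAddGroup_of_addCommGroup (G := k)
  have : IsPrecomplete 𝓂[k] (Fin e × Fin r → 𝒪[k]) := isPrecomplete_pi _
  have : IsHausdorff 𝓂[k] (maxOrderSubalgebra k D) := isHausdorff_maxOrder
  have hf : Function.Surjective f := by
    refine surjective_of_mkQ_comp_surjective (I := 𝓂[k]) fun q => ?_
    obtain ⟨x, rfl⟩ := Submodule.mkQ_surjective _ q
    obtain ⟨c, y, hy⟩ := exists_expansion hϖ hg e x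
    refine ⟨fun a => c a.1 a.2, ?_⟩
    rw [LinearMap.comp_apply, Submodule.mkQ_apply, Submodule.mkQ_apply, Submodule.Quotient.eq]
    have h1 : f (fun a => c a.1 a.2) - x = -(y * primeElement hϖ ^ e) := by
      rw [hy, Fintype.linearCombination_apply, Fintype.sum_prod_type]
      simp only [v]
      abel
    rw [h1]
    refine Submodule.neg_mem _ ?_
    have h2 : (algebraMap k D p)⁻¹ * (y * (ϖ : D) ^ e) ∈ maxOrderSubalgebra k D := by
      rw [mem_maxOrderSubalgebra]
      by_cases hy0 : (y : D) = 0
      · simp [hy0]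
      right
      have h3 := (mem_maxOrderSubalgebra.mp y.2).resolve_left hy0
      have h4 := ord_units_zpow (k := k) ϖ e
      rw [zpow_natCast, Units.val_pow_eq_pow_val] at h4
      have h5 : (ϖ : D) ^ e ≠ 0 := pow_ne_zero _ (Units.ne_zero _)
      rw [ord_mul (inv_ne_zero hpD) (mul_ne_zero hy0 h5), ord_mul hy0 h5, ord_inv, he, h4]
      omega
    have h6 : y * primeElement hϖ ^ e = (⟨p, hpR⟩ : 𝒪[k]) • ⟨_, h2⟩ := by
      apply Subtype.ext
      rw [coe_smul_maxOrder]
      change (y : D) * (ϖ : D) ^ e = algebraMap k D p * ((algebraMap k D p)⁻¹ * (y * (ϖ : D) ^ e))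
      rw [mul_inv_cancel_left₀ hpD]
    rw [h6]
    exact Submodule.smul_mem_smul hpm trivial
  have hspan : Submodule.span k (Set.range fun a => (v a : D)) = ⊤ := by
    rw [eq_top_iff]
    intro x _
    -- a large power of `p` moves `x` into `Δ`
    obtain ⟨m, hm, -, ⟨φ⟩⟩ := exists_splitting (k := k) D
    set N := (-ord k x).toNat with hN
    have h1 : algebraMap k D (p ^ N) * x ∈ maxOrderSubalgebra k D := by
      rw [mem_maxOrderSubalgebra]
      by_cases hx0 : x = 0
      · simp [hx0]
      right
      rw [ord_mul (by simpa using fun h => absurd h hp0) hx0, ord_algebraMap φ (pow_ne_zero _ hp0),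
        val_pow hp0, hp1, mul_one]
      have : 1 ≤ (m : ℤ) := by exact_mod_cast Nat.one_le_iff_ne_zero.mpr hm
      have : (N : ℤ) ≤ m * N := by nlinarith
      omega
    obtain ⟨c, hc⟩ := hf ⟨_, h1⟩
    have h2 := congrArg Subtype.val hc
    rw [Fintype.linearCombination_apply, AddSubmonoidClass.coe_finsetSum] at h2
    have h3 : x = (p ^ N)⁻¹ • ∑ a, ((c a : 𝒪[k]) : k) • (v a : D) := by
      rw [eq_inv_smul_iff₀ (pow_ne_zero _ hp0), Algebra.smul_def]
      exact h2.symm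
    rw [h3]
    exact Submodule.smul_mem _ _ (Submodule.sum_mem _ fun a _ =>
      Submodule.smul_mem _ _ (Submodule.subset_span ⟨a, rfl⟩))
  have h := finrank_range_le_card (R := k) (fun a => (v a : D))
  rw [Set.finrank, hspan, finrank_top] at h
  simpa using h

variable (k D) in
/-- A lift `g` of a generator of the multiplicative group of the residue field of `D`. -/
theorem exists_residue_generator : ∃ g : maxOrderSubalgebra k D, residue k D g ≠ 0 ∧
    ∀ x : ResidueRing k D, x ≠ 0 → ∃ i : ℕ, x = residue k D g ^ i := by
  obtain ⟨u, hu⟩ := IsCyclic.exists_monoid_generator (α := (ResidueRing k D)ˣ)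
  obtain ⟨g, hg⟩ := residue_surjective (u : ResidueRing k D)
  refine ⟨g, hg ▸ u.ne_zero, fun x hx => ?_⟩
  obtain ⟨i, hi⟩ := Submonoid.mem_powers_iff _ _ |>.mp (hu (Units.mk0 x hx))
  refine ⟨i, ?_⟩
  rw [hg, ← Units.val_pow_eq_pow_val, hi, Units.val_mk0]

/-- The powers of a generator of the residue field below its degree `f` over the residue field of `k`
form a system of generators. -/
theorem exists_residue_sub_sum_eq_zero {g : maxOrderSubalgebra k D}
    (hg : ∀ x : ResidueRing k D, x ≠ 0 → ∃ i : ℕ, x = residue k D g ^ i)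
    (x : maxOrderSubalgebra k D) :
    ∃ c : Fin (minpoly 𝓀[k] (residue k D g)).natDegree → 𝒪[k],
      residue k D (x - ∑ i, c i • g ^ (i : ℕ)) = 0 := by
  have hint : IsIntegral 𝓀[k] (residue k D g) := Algebra.IsIntegral.isIntegral _
  obtain ⟨Q, hQ⟩ : ∃ Q : 𝓀[k][X], aeval (residue k D g) Q = residue k D x := by
    by_cases h : residue k D x = 0
    · exact ⟨0, by rw [h, map_zero]⟩
    · obtain ⟨i, hi⟩ := hg _ h
      exact ⟨X ^ i, by rw [hi, map_pow, aeval_X]⟩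
  set P := minpoly 𝓀[k] (residue k D g) with hP
  have h1 : aeval (residue k D g) (Q %ₘ P) = residue k D x := by
    rw [← hQ, aeval_modByMonic_eq_self_of_root (minpoly.aeval _ _)]
  have h2 : (Q %ₘ P).natDegree < P.natDegree :=
    natDegree_modByMonic_lt _ (minpoly.monic hint) (minpoly.ne_one _ _)
  choose s hs using fun a : 𝓀[k] => IsLocalRing.residue_surjective a
  refine ⟨fun i => s ((Q %ₘ P).coeff i), ?_⟩
  rw [map_sub, ← h1, aeval_eq_sum_range' h2, Finset.sum_range, map_sum, sub_eq_zero]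
  refine Finset.sum_congr rfl fun i _ => ?_
  rw [← residue_smul_residue, hs, map_pow]

/-- The two equalities `e = f = m` for a central division algebra of degree `m` over a local field,
where `e` is the ramification index and `f` the residue degree: `e` is at most `m` because `ϖ`
has integral reduced norm, `f` is at most `m` because elements of `D` have degree at most `m`, and
`e f` is at least `m ^ 2 = [D : k]` by completeness. -/
theorem ord_prime_and_natDegree (hϖ : IsPrimeElement k ϖ) {m : ℕ} (hm : m ≠ 0)
    (hmD : m * m = Module.finrank k D)
    (φ : (AlgebraicClosure k ⊗[k] D) ≃ₐ[AlgebraicClosure k]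
      Matrix (Fin m) (Fin m) (AlgebraicClosure k))
    {g : maxOrderSubalgebra k D}
    (hg : ∀ x : ResidueRing k D, x ≠ 0 → ∃ i : ℕ, x = residue k D g ^ i) :
    ord k (ϖ : D) = 1 ∧ ∃ Q : 𝒪[k][X], Q.Monic ∧ Q.natDegree = m ∧ aeval (g : D) Q = 0 ∧
      Q.map (IsLocalRing.residue 𝒪[k]) = minpoly 𝓀[k] (residue k D g) := by
  obtain ⟨p, hp0, hp1⟩ := exists_val_eq_one k
  have hpos := ord_prime_pos hϖ
  have hpD : algebraMap k D p ≠ 0 := by simpa using hp0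
  have hordp := ord_algebraMap (D := D) φ hp0
  rw [hp1, mul_one] at hordp
  obtain ⟨e', he'⟩ := ord_prime_dvd hϖ hpD
  have hmpos : 0 < (m : ℤ) := by exact_mod_cast Nat.pos_of_ne_zero hm
  have he'pos : 0 < e' := by
    rw [hordp] at he'
    by_contra h
    nlinarith
  lift e' to ℕ using he'pos.le with e
  have he : ord k (algebraMap k D p) = e * ord k (ϖ : D) := by rw [he', mul_comm]
  have h1 := finrank_le_mul hϖ (exists_residue_sub_sum_eq_zero hg) hp0 hp1 he
  obtain ⟨Q, hQm, hQ, hQg⟩ := exists_map_eq_minpoly (k := k) (show IsIntegral 𝒪[k] (g : D) from g.2)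
  have hQd : Q.natDegree ≤ m := by
    have := natDegree_minpoly_le φ (g : D)
    rwa [← hQ, hQm.natDegree_map] at this
  have hQg' : aeval g Q = 0 := by
    apply Subtype.ext
    exact (aeval_algHom_apply (maxOrderSubalgebra k D).val g Q).symm.trans hQg
  have hQr : aeval (residue k D g) (Q.map (IsLocalRing.residue 𝒪[k])) = 0 := by
    rw [← residue_aeval, hQg', map_zero]
  have hdvd := minpoly.dvd _ _ hQr
  have hQm' := hQm.map (IsLocalRing.residue 𝒪[k])
  have h2 : (minpoly 𝓀[k] (residue k D g)).natDegree ≤ Q.natDegree := by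
    have := natDegree_le_of_dvd hdvd hQm'.ne_zero
    rwa [hQm.natDegree_map] at this
  set r := (minpoly 𝓀[k] (residue k D g)).natDegree with hr
  rw [← hmD] at h1
  have hem : e ≤ m := by
    have : (e : ℤ) ≤ m := by rw [← hordp, he]; nlinarith
    exact_mod_cast this
  have hmr : m ≤ r := by
    by_contra h
    nlinarith
  have hme : m ≤ e := by
    by_contra h
    nlinarith
  have heq : e = m := le_antisymm hem hme
  refine ⟨?_, Q, hQm, by omega, hQg, ?_⟩
  · rw [hordp, heq] at he
    nlinarith
  · refine (eq_of_monic_of_dvd_of_natDegree_le (minpoly.monic (Algebra.IsIntegral.isIntegral _))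
      hQm' hdvd ?_)
    rw [hQm.natDegree_map]
    omega

end DivisionAlgebra

/-! ### Surjectivity of the reduced norm on units -/

section Hensel

open Polynomial

theorem smodEq_map {R M N : Type*} [CommRing R] [AddCommGroup M] [Module R M] [AddCommGroup N]
    [Module R N] {I : Ideal R} (f : M →ₗ[R] N) {x y : M}
    (h : x ≡ y [SMOD (I • ⊤ : Submodule R M)]) : f x ≡ f y [SMOD (I • ⊤ : Submodule R N)] := by
  have := h.map f
  rw [Submodule.map_smul''] at this
  exact this.mono (Submodule.smul_mono le_rfl le_top)

theorem isPrecomplete_of_basis {R M ι : Type*} [CommRing R] [AddCommGroup M] [Module R M]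
    [Finite ι] (b : Module.Basis ι R M) (I : Ideal R) [IsPrecomplete I R] : IsPrecomplete I M := by
  have := isPrecomplete_pi (ι := ι) I
  refine ⟨fun f hf => ?_⟩
  obtain ⟨L, hL⟩ := IsPrecomplete.prec' (I := I) (fun n => b.equivFun (f n))
    fun {a c} hac => smodEq_map b.equivFun.toLinearMap (hf hac)
  refine ⟨b.equivFun.symm L, fun n => ?_⟩
  have := smodEq_map b.equivFun.symm.toLinearMap (hL n)
  rwa [LinearEquiv.coe_coe, LinearEquiv.symm_apply_apply] at this

theorem aeval_mem_map_of_map_residue_eq_zero {R S : Type*} [CommRing R] [IsLocalRing R] [CommRing S]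
    [Algebra R S] (F : R[X]) (hF : F.map (IsLocalRing.residue R) = 0) (a : S) :
    aeval a F ∈ (IsLocalRing.maximalIdeal R).map (algebraMap R S) := by
  rw [aeval_eq_sum_range]
  refine Ideal.sum_mem _ fun i _ => ?_
  rw [Algebra.smul_def]
  refine Ideal.mul_mem_right _ _ (Ideal.mem_map_of_mem _ ?_)
  rw [← IsLocalRing.residue_eq_zero_iff, ← coeff_map, hF, coeff_zero]

/-- Two monic polynomials over a complete discrete valuation ring with the same separable
reduction generate the same extension: the first has a root in the extension generated by a root of
the second, by Hensel's lemma. -/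
theorem exists_dvd_comp {R : Type*} [CommRing R] [IsDomain R] [IsDiscreteValuationRing R]
    [IsAdicComplete (IsLocalRing.maximalIdeal R) R] {P Q : R[X]} (hP : P.Monic) (hQ : Q.Monic)
    (hPQ : P.map (IsLocalRing.residue R) = Q.map (IsLocalRing.residue R))
    (hsep : (Q.map (IsLocalRing.residue R)).Separable) : ∃ F : R[X], Q ∣ P.comp F := by
  let S := AdjoinRoot Q
  let I := (IsLocalRing.maximalIdeal R).map (algebraMap R S)
  let pb := AdjoinRoot.powerBasis' hQ
  have hfin : Module.Finite R S := pb.finite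
  have h1 : IsPrecomplete I S := IsPrecomplete.map_algebraMap_iff.mpr
    (isPrecomplete_of_basis pb.basis _)
  have h2 : IsHausdorff I S := IsHausdorff.map_algebraMap_iff.mpr inferInstance
  have h3 : IsAdicComplete I S := {}
  have hmem := fun (F : R[X]) (hF : F.map (IsLocalRing.residue R) = 0) =>
    aeval_mem_map_of_map_residue_eq_zero F hF (AdjoinRoot.root Q)
  have hroot : aeval (AdjoinRoot.root Q) Q = 0 := by rw [AdjoinRoot.aeval_eq, AdjoinRoot.mk_self]
  obtain ⟨A, B, hAB⟩ := hsep
  obtain ⟨A, rfl⟩ := map_surjective _ IsLocalRing.residue_surjective A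
  obtain ⟨B, rfl⟩ := map_surjective _ IsLocalRing.residue_surjective B
  have hev : ∀ (G : R[X]) (s : S), (G.map (algebraMap R S)).eval s = aeval s G :=
    fun G s => eval_map_algebraMap G s
  obtain ⟨a, ha, -⟩ := HenselianRing.is_henselian (I := I) (P.map (algebraMap R S)) (hP.map _)
    (AdjoinRoot.root Q) (by
      rw [hev]
      have := hmem (P - Q) (by rw [Polynomial.map_sub, hPQ, sub_self])
      rwa [map_sub, hroot, sub_zero] at this) (by
      rw [derivative_map, hev]
      have := hmem (B * derivative P - 1 + A * Q) (by
        rw [← sub_eq_zero.mpr hAB]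
        simp only [Polynomial.map_add, Polynomial.map_sub, Polynomial.map_mul, Polynomial.map_one,
          ← derivative_map, hPQ]
        ring)
      rw [map_add, map_mul, hroot, mul_zero, add_zero, map_sub, map_mul, map_one] at this
      rw [← Ideal.Quotient.eq_zero_iff_mem, map_sub, map_mul, map_one, sub_eq_zero] at this
      exact IsUnit.of_mul_eq_one_right _ this)
  obtain ⟨F, rfl⟩ := AdjoinRoot.mk_surjective a
  refine ⟨F, ?_⟩
  rw [← AdjoinRoot.mk_eq_zero, ← AdjoinRoot.aeval_eq, aeval_comp, AdjoinRoot.aeval_eq, ← hev]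
  exact ha

/-- If the powers of `g` exhaust the nonzero elements of a finite field, then the powers of its norm
exhaust those of a subfield. -/
theorem exists_eq_pow_coeff_zero_minpoly {K L : Type*} [Field K] [Field L] [Algebra K L] [Finite L]
    {g : L} (hg0 : g ≠ 0) (hg : ∀ x : L, x ≠ 0 → ∃ i : ℕ, x = g ^ i) :
    (minpoly K g).coeff 0 ≠ 0 ∧ ∀ u : K, u ≠ 0 →
      ∃ j : ℕ, ((-1) ^ (minpoly K g).natDegree * (minpoly K g).coeff 0) ^ j = u := by
  have hint : IsIntegral K g := Algebra.IsIntegral.isIntegral _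
  have hadj : Algebra.adjoin K {g} = ⊤ := by
    rw [eq_top_iff]
    intro z _
    by_cases hz : z = 0
    · rw [hz]; exact Subalgebra.zero_mem _
    · obtain ⟨i, rfl⟩ := hg z hz
      exact Subalgebra.pow_mem _ (Algebra.self_mem_adjoin_singleton K g) i
  have hnorm : Algebra.norm K g = (-1) ^ (minpoly K g).natDegree * (minpoly K g).coeff 0 := by
    obtain ⟨pb, h1⟩ : ∃ pb : PowerBasis K L, pb.gen = g :=
      ⟨PowerBasis.ofAdjoinEqTop' hint hadj, PowerBasis.ofAdjoinEqTop'_gen hint hadj⟩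
    have h2 := Algebra.PowerBasis.norm_gen_eq_coeff_zero_minpoly pb
    rwa [← PowerBasis.natDegree_minpoly, h1] at h2
  refine ⟨minpoly.coeff_zero_ne_zero hint hg0, fun u hu => ?_⟩
  have : Finite K := Finite.of_injective _ (algebraMap K L).injective
  obtain ⟨y, hy⟩ := FiniteField.norm_surjective K L u
  have hy0 : y ≠ 0 := by
    rintro rfl
    exact hu (by rw [← hy, Algebra.norm_zero])
  obtain ⟨j, rfl⟩ := hg y hy0
  exact ⟨j, by rw [← hnorm, ← map_pow, hy]⟩

end Hensel

section DivisionAlgebra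

open Polynomial ValuativeRel

variable {k : Type*} [Field k] [CharZero k]
  {D : Type*} [DivisionRing D] [Algebra k D] [Algebra.IsCentral k D] [FiniteDimensional k D]
  [ValuativeRel k] [TopologicalSpace k] [IsNonarchimedeanLocalField k]

omit [Algebra.IsCentral k D] in
/-- An integral polynomial of degree `m` with irreducible reduction is the minimal polynomial of
its roots in `D`, which therefore have the largest possible degree. -/
theorem reducedNorm_eq_of_irreducible_residue {m : ℕ}
    (φ : (AlgebraicClosure k ⊗[k] D) ≃ₐ[AlgebraicClosure k]
      Matrix (Fin m) (Fin m) (AlgebraicClosure k)) {P : 𝒪[k][X]} (hP : P.Monic)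
    (hPm : P.natDegree = m) (hPi : Irreducible (P.map (IsLocalRing.residue 𝒪[k]))) {x : D}
    (hx : aeval x P = 0) : reducedNorm k x = (-1) ^ m * (P.coeff 0 : k) := by
  have h1 : Irreducible (P.map (algebraMap 𝒪[k] k)) :=
    (hP.irreducible_iff_irreducible_map_fraction_map (K := k)).mp
      (hP.irreducible_of_irreducible_map _ _ hPi)
  have h2 : P.map (algebraMap 𝒪[k] k) = minpoly k x :=
    minpoly.eq_of_irreducible_of_monic h1 (by rwa [aeval_map_algebraMap]) (hP.map _)
  rw [reducedNorm_eq_of_natDegree_minpoly φ (by rw [← h2, hP.natDegree_map, hPm]), ← h2, coeff_map]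
  rfl

/-- The reduced norm maps `Δˣ` onto `Rˣ`. Modulo `𝔭` this is the surjectivity of the norm of
finite fields. An element of `Rˣ` that is congruent to the reduced norm of a lift `g` of a
generator of the residue field of `D` is the reduced norm of a root of a polynomial with the
same reduction as the minimal polynomial of `g`. -/
theorem exists_reducedNorm_eq {ϖ : Dˣ} (hϖ : IsPrimeElement k ϖ) {u : k} (hu : u ≠ 0)
    (hu0 : val u = 0) : ∃ x : Dˣ, reducedNorm k (x : D) = u := by
  obtain ⟨m, hm, hmD, ⟨φ⟩⟩ := exists_splitting (k := k) D
  obtain ⟨g, hg0, hg⟩ := exists_residue_generator k D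
  obtain ⟨-, Q, hQ, hQm, hQg, hQr⟩ := ord_prime_and_natDegree hϖ hm hmD φ hg
  have hint : IsIntegral 𝓀[k] (residue k D g) := Algebra.IsIntegral.isIntegral _
  have hgD : (g : D) ≠ 0 := fun h => hg0 (residue_eq_zero_iff.mpr (Or.inl h))
  have hirr : Irreducible (Q.map (IsLocalRing.residue 𝒪[k])) := hQr ▸ minpoly.irreducible hint
  -- elements of `R` that are congruent to the reduced norm of `g`
  have key : ∀ c : 𝒪[k], IsLocalRing.residue 𝒪[k] c = IsLocalRing.residue 𝒪[k] (Q.coeff 0) →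
      ∃ x : D, reducedNorm k x = (-1) ^ m * (c : k) := by
    intro c hc
    set P := Q + C (c - Q.coeff 0) with hPdef
    have hdeg : (C (c - Q.coeff 0)).degree < Q.degree :=
      degree_C_le.trans_lt (natDegree_pos_iff_degree_pos.mp (by omega))
    have hP : P.Monic := hQ.add_of_left hdeg
    have hPm : P.natDegree = m := by rw [hPdef, natDegree_add_C, hQm]
    have hPQ : P.map (IsLocalRing.residue 𝒪[k]) = Q.map (IsLocalRing.residue 𝒪[k]) := by
      rw [hPdef, Polynomial.map_add, map_C, map_sub, hc, sub_self, C_0, add_zero]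
    let := IsTopologicalAddGroup.rightUniformSpace k
    have := isUniformAddGroup_of_addCommGroup (G := k)
    obtain ⟨F, G, hF⟩ := exists_dvd_comp hP hQ hPQ (hQr ▸ Algebra.IsSeparable.isSeparable _ _)
    refine ⟨aeval (g : D) F, ?_⟩
    rw [reducedNorm_eq_of_irreducible_residue φ hP hPm (hPQ ▸ hirr) (x := aeval (g : D) F)
      (by rw [← aeval_comp, hF, map_mul, hQg, zero_mul])]
    simp [hPdef]
  have hnrg := reducedNorm_eq_of_irreducible_residue φ hQ hQm hirr hQg
  -- the reduction of `u` is a power of the norm of the generator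
  have huR : u ∈ 𝒪[k] := (mem_integer_iff_val hu).mpr hu0.ge
  set u' : 𝒪[k] := ⟨u, huR⟩
  have hur : IsLocalRing.residue 𝒪[k] u' ≠ 0 := by
    rw [ne_eq, IsLocalRing.residue_eq_zero_iff, mem_maximalIdeal_iff]
    simp [u', hu, hu0]
  obtain ⟨hc0, hpow⟩ := exists_eq_pow_coeff_zero_minpoly (K := 𝓀[k]) hg0 hg
  rw [← hQr, coeff_map] at hc0
  obtain ⟨j, hy⟩ := hpow _ hur
  rw [← hQr, coeff_map, hQ.natDegree_map, hQm] at hy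
  set c0 : 𝒪[k] := (-1) ^ m * Q.coeff 0 with hc0'
  have hc0e : IsLocalRing.residue 𝒪[k] c0 =
      (-1) ^ m * IsLocalRing.residue 𝒪[k] (Q.coeff 0) := by
    rw [hc0', map_mul, map_pow, map_neg, map_one]
  have hc0r : IsLocalRing.residue 𝒪[k] c0 ≠ 0 := by
    rw [hc0e]
    exact mul_ne_zero (pow_ne_zero _ (neg_ne_zero.mpr one_ne_zero)) hc0
  rw [← hc0e, ← map_pow] at hy
  have hc0u : IsUnit c0 := (IsLocalRing.residue_ne_zero_iff_isUnit _).mp hc0r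
  have hgc : reducedNorm k (g : D) = c0 := by rw [hnrg, hc0']; simp
  -- `u = c₀ ^ j w` with `w` congruent to `1`
  obtain ⟨v, hv⟩ := hc0u.pow j
  have hw : IsLocalRing.residue 𝒪[k] (u' * (v⁻¹ : (𝒪[k])ˣ)) = 1 := by
    rw [map_mul, ← hy, ← hv, ← map_mul, Units.mul_inv, map_one]
  obtain ⟨x, hx⟩ := key (Q.coeff 0 * (u' * (v⁻¹ : (𝒪[k])ˣ))) (by rw [map_mul, hw, mul_one])
  have hxc : reducedNorm k x * (c0 : k) ^ j = c0 * u := by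
    have h1 : (-1) ^ m * (Q.coeff 0 * (u' * (v⁻¹ : (𝒪[k])ˣ))) * c0 ^ j = c0 * u' := by
      rw [← hv, hc0']
      have := Units.inv_mul v
      linear_combination ((-1) ^ m * (Q.coeff 0 * u')) * this
    have h2 := congrArg (fun z : 𝒪[k] => (z : k)) h1
    rw [hx]
    simpa using h2
  have hc0k : (c0 : k) ≠ 0 := by
    intro h
    exact hc0u.ne_zero (Subtype.ext h)
  have hpow : ∀ i : ℕ, reducedNorm k ((g : D) ^ i) = (c0 : k) ^ i := fun i => by
    induction i with
    | zero => simp [reducedNorm_one_of_divisionRing]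
    | succ i ih => rw [pow_succ, reducedNorm_mul_of_divisionRing, ih, hgc, pow_succ]
  have hfin : reducedNorm k (x * (g : D) ^ j * (g : D)⁻¹) = u := by
    have h1 := reducedNorm_mul_of_divisionRing k (x * (g : D) ^ j * (g : D)⁻¹) g
    rw [mul_assoc _ _ (g : D), inv_mul_cancel₀ hgD, mul_one, reducedNorm_mul_of_divisionRing, hpow,
      hgc, hxc, mul_comm] at h1
    exact (mul_right_cancel₀ hc0k h1).symm
  refine ⟨Units.mk0 _ ?_, hfin⟩
  intro h
  rw [h] at hfin
  have : reducedNorm k (0 : D) = 0 := by simpa [hm] using reducedNorm_algebraMap φ 0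
  exact hu (by rw [← hfin, this])

/-- `ord` is the normalized valuation of `D`. -/
theorem ord_prime {ϖ : Dˣ} (hϖ : IsPrimeElement k ϖ) : ord k (ϖ : D) = 1 := by
  obtain ⟨m, hm, hmD, ⟨φ⟩⟩ := exists_splitting (k := k) D
  obtain ⟨g, -, hg⟩ := exists_residue_generator k D
  exact (ord_prime_and_natDegree hϖ hm hmD φ hg).1

theorem mem_primePow_iff {ϖ : Dˣ} (hϖ : IsPrimeElement k ϖ) {a : ℤ} {x : D} :
    x ∈ primePow k ϖ a ↔ x = 0 ∨ a ≤ ord k x := by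
  rw [mem_primePow_iff_mul, ord_prime hϖ, mul_one]

end DivisionAlgebra

/-! ### Conjugates and normalizers of orders -/

section Conj

variable {k : Type*} [Field k] [ValuativeRel k] {A : Type*} [Ring A] [Algebra k A]

theorem mem_conj {g : Aˣ} {Γ : Subalgebra 𝒪[k] A} {x : A} :
    x ∈ conj g Γ ↔ (↑g⁻¹ : A) * x * (g : A) ∈ Γ := Iff.rfl

theorem conj_mul (g h : Aˣ) (Γ : Subalgebra 𝒪[k] A) : conj (g * h) Γ = conj g (conj h Γ) := by
  ext x
  simp only [mem_conj, mul_inv_rev, Units.val_mul, mul_assoc]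

theorem conj_one (Γ : Subalgebra 𝒪[k] A) : conj 1 Γ = Γ := by
  ext x
  simp [mem_conj]

theorem conj_eq_self_of_mem {g : Aˣ} {Γ : Subalgebra 𝒪[k] A} (h1 : (g : A) ∈ Γ)
    (h2 : (↑g⁻¹ : A) ∈ Γ) : conj g Γ = Γ := by
  ext x
  rw [mem_conj]
  refine ⟨fun h => ?_, fun h => Γ.mul_mem (Γ.mul_mem h2 h) h1⟩
  have := Γ.mul_mem (Γ.mul_mem h1 h) h2
  simpa [mul_assoc] using this

theorem mem_normalizer {g : Aˣ} {Γ : Subalgebra 𝒪[k] A} :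
    g ∈ normalizer Γ ↔ conj g Γ = Γ := Iff.rfl

theorem mem_normalizer_conj {g h : Aˣ} {Γ : Subalgebra 𝒪[k] A} :
    h ∈ normalizer (conj g Γ) ↔ g⁻¹ * h * g ∈ normalizer Γ := by
  rw [mem_normalizer, mem_normalizer, ← conj_mul]
  constructor <;> intro H
  · rw [mul_assoc, conj_mul, H, ← conj_mul, inv_mul_cancel, conj_one]
  · rw [mul_assoc, conj_mul] at H
    conv_rhs => rw [← H, ← conj_mul, mul_inv_cancel, conj_one]

theorem IsOrder.conj {Γ : Subalgebra 𝒪[k] A} (hΓ : IsOrder k Γ) (g : Aˣ) :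
    IsOrder k (conj g Γ) := by
  let f : A →ₗ[k] A := (LinearMap.mulLeft k (g : A)).comp (LinearMap.mulRight k (↑g⁻¹ : A))
  have hf : ∀ x, f x = (g : A) * (x * (↑g⁻¹ : A)) := fun x => rfl
  have hset : (TiledOrder.conj g Γ : Set A) = f '' (Γ : Set A) := by
    ext x
    simp only [SetLike.mem_coe, mem_conj, Set.mem_image, hf]
    constructor
    · exact fun h => ⟨_, h, by simp [mul_assoc]⟩
    · rintro ⟨y, hy, rfl⟩
      simpa [mul_assoc] using hy
  constructor
  · have h1 : Subalgebra.toSubmodule (TiledOrder.conj g Γ) =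
        (Subalgebra.toSubmodule Γ).map (f.restrictScalars 𝒪[k]) := by
      apply SetLike.coe_injective
      rw [Submodule.map_coe]
      exact hset
    rw [h1]
    exact hΓ.fg.map _
  · rw [hset, Submodule.span_image, hΓ.span_eq_top, Submodule.map_top, LinearMap.range_eq_top]
    exact fun y => ⟨(↑g⁻¹ : A) * y * g, by simp [hf, mul_assoc]⟩

end Conj

/-! ### Exponent matrices -/

section Exponents

open ValuativeRel

variable {k : Type*} [Field k] [CharZero k]
  {D : Type*} [DivisionRing D] [Algebra k D] [Algebra.IsCentral k D] [FiniteDimensional k D]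
  [ValuativeRel k] [TopologicalSpace k] [IsNonarchimedeanLocalField k]
  {ϖ : Dˣ} {n : ℕ}

theorem mul_mem_primePow (hϖ : IsPrimeElement k ϖ) {a b c : ℤ} {x y : D} (hx : x ∈ primePow k ϖ a)
    (hy : y ∈ primePow k ϖ b) (hc : c ≤ a + b) : x * y ∈ primePow k ϖ c := by
  rw [mem_primePow_iff hϖ] at *
  exact (ord_mul_le hx hy).imp_right hc.trans

theorem add_mem_primePow (hϖ : IsPrimeElement k ϖ) {a : ℤ} {x y : D} (hx : x ∈ primePow k ϖ a)
    (hy : y ∈ primePow k ϖ a) : x + y ∈ primePow k ϖ a := by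
  rw [mem_primePow_iff hϖ] at *
  exact ord_add hx hy

theorem zero_mem_primePow (hϖ : IsPrimeElement k ϖ) (a : ℤ) : (0 : D) ∈ primePow k ϖ a :=
  (mem_primePow_iff hϖ).mpr (Or.inl rfl)

theorem sum_mem_primePow (hϖ : IsPrimeElement k ϖ) {a : ℤ} {ι : Type*} (s : Finset ι) (f : ι → D)
    (hf : ∀ i ∈ s, f i ∈ primePow k ϖ a) : ∑ i ∈ s, f i ∈ primePow k ϖ a :=
  Finset.sum_induction _ (· ∈ primePow k ϖ a) (fun _ _ => add_mem_primePow hϖ)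
    (zero_mem_primePow hϖ a) hf

theorem ord_prime_zpow (hϖ : IsPrimeElement k ϖ) (a : ℤ) : ord k ((ϖ ^ a : Dˣ) : D) = a := by
  rw [ord_units_zpow, ord_prime hϖ, mul_one]

theorem zpow_mem_primePow (hϖ : IsPrimeElement k ϖ) {a b : ℤ} (h : b ≤ a) :
    ((ϖ ^ a : Dˣ) : D) ∈ primePow k ϖ b :=
  (mem_primePow_iff hϖ).mpr (Or.inr (by rwa [ord_prime_zpow hϖ]))

theorem one_mem_primePow_iff (hϖ : IsPrimeElement k ϖ) {a : ℤ} :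
    (1 : D) ∈ primePow k ϖ a ↔ a ≤ 0 := by
  rw [mem_primePow_iff hϖ, ord_one]
  simp

theorem zpow_mul_mul_zpow_mem_primePow (hϖ : IsPrimeElement k ϖ) {a b c : ℤ} {x : D} :
    ((ϖ ^ a : Dˣ) : D) * x * ((ϖ ^ b : Dˣ) : D) ∈ primePow k ϖ c ↔
      x ∈ primePow k ϖ (c - a - b) := by
  rw [mem_primePow_iff hϖ, mem_primePow_iff hϖ]
  by_cases hx : x = 0
  · simp [hx]
  rw [ord_mul (mul_ne_zero (Units.ne_zero _) hx) (Units.ne_zero _),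
    ord_mul (Units.ne_zero _) hx, ord_prime_zpow hϖ, ord_prime_zpow hϖ]
  simp only [mul_eq_zero, Units.ne_zero, hx, or_self, false_or]
  omega

variable {Γ : Subalgebra 𝒪[k] (Matrix (Fin n) (Fin n) D)} {μ : Matrix (Fin n) (Fin n) ℤ}

omit [CharZero k] [Algebra.IsCentral k D] [FiniteDimensional k D] [TopologicalSpace k]
  [IsNonarchimedeanLocalField k] in
theorem single_mem_of_containsDiag (hdiag : ContainsDiag Γ) {x : Matrix (Fin n) (Fin n) D}
    (hx : x ∈ Γ) (i j : Fin n) : Matrix.single i j (x i j) ∈ Γ := by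
  have h0 : (0 : D) ∈ maxOrder k D := isIntegral_zero
  have h1 : (1 : D) ∈ maxOrder k D := isIntegral_one
  have hE : ∀ i : Fin n, Matrix.single i i (1 : D) ∈ Γ := fun i => by
    rw [← Matrix.diagonal_single]
    refine hdiag _ fun j => ?_
    by_cases h : j = i
    · subst h; simpa using h1
    · simpa [h] using h0
  have := Γ.mul_mem (Γ.mul_mem (hE i) hx) (hE j)
  rwa [Matrix.single_mul_mul_single, one_mul, mul_one] at this

/-- An order that contains `diag(Δ, …, Δ)` is `(𝔭 ^ μ_ij)` for some integers `μ_ij`. -/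
theorem exists_isExponentMatrix (hϖ : IsPrimeElement k ϖ) (hΓ : IsOrder k Γ)
    (hdiag : ContainsDiag Γ) : ∃ μ, IsExponentMatrix ϖ Γ μ := by
  -- the entries of the elements of `Γ` are bounded
  have hbdd : ∃ N : ℤ, ∀ x ∈ Γ, ∀ i j, x i j ∈ primePow k ϖ N := by
    obtain ⟨S, hS⟩ := hΓ.fg
    obtain ⟨N, hN⟩ := (((S ×ˢ (Finset.univ : Finset (Fin n × Fin n))).image
      fun a => ord k (a.1 a.2.1 a.2.2)).finite_toSet).bddBelow
    refine ⟨N, fun x hx i j => ?_⟩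
    rw [← Subalgebra.mem_toSubmodule, ← hS] at hx
    induction hx using Submodule.span_induction with
    | mem x hx =>
      exact (mem_primePow_iff hϖ).mpr (Or.inr (hN (Finset.mem_coe.mpr (Finset.mem_image.mpr
        ⟨(x, i, j), by simpa using hx, rfl⟩))))
    | zero => exact zero_mem_primePow hϖ N
    | add x y _ _ hx hy => exact add_mem_primePow hϖ hx hy
    | smul a x _ hx =>
      have ha : algebraMap k D (a : k) ∈ primePow k ϖ 0 :=
        (mem_primePow_iff hϖ).mpr (mem_maxOrder_iff.mp (isIntegral_algebraMap (x := a)))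
      have := mul_mem_primePow hϖ ha hx (zero_add N).ge
      rwa [← Algebra.smul_def] at this
  obtain ⟨N, hN⟩ := hbdd
  -- the exponent is the least order of an entry in position `(i, j)`
  have hmin : ∀ i j, ∃ a : ℤ, (∃ x ∈ Γ, x i j ≠ 0 ∧ ord k (x i j) = a) ∧
      ∀ z, (∃ x ∈ Γ, x i j ≠ 0 ∧ ord k (x i j) = z) → a ≤ z := by
    intro i j
    refine Int.exists_least_of_bdd ⟨N, ?_⟩ ?_
    · rintro z ⟨x, hx, hx0, rfl⟩
      exact ((mem_primePow_iff hϖ).mp (hN x hx i j)).resolve_left hx0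
    · by_contra! h
      have h1 : Submodule.span k (Γ : Set (Matrix (Fin n) (Fin n) D)) ≤
          LinearMap.ker (Matrix.entryLinearMap k D i j) := by
        rw [Submodule.span_le]
        intro x hx
        by_contra h0
        exact h _ x hx h0 rfl
      rw [hΓ.span_eq_top] at h1
      have := h1 (x := Matrix.single i j 1) trivial
      simp at this
  choose μ hμ hμmin using hmin
  refine ⟨μ, fun x => ⟨fun hx i j => (mem_primePow_iff hϖ).mpr ?_, fun hx => ?_⟩⟩
  · rw [or_iff_not_imp_left]
    exact fun h0 => hμmin i j _ ⟨x, hx, h0, rfl⟩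
  rw [Matrix.matrix_eq_sum_single x]
  refine Γ.sum_mem fun i _ => Γ.sum_mem fun j _ => ?_
  obtain ⟨y, hy, hy0, hyμ⟩ := hμ i j
  by_cases hx0 : x i j = 0
  · rw [hx0, Matrix.single_zero]; exact Γ.zero_mem
  have h1 := ((mem_primePow_iff hϖ).mp (hx i j)).resolve_left hx0
  have h2 : x i j * (y i j)⁻¹ ∈ maxOrder k D := by
    rw [mem_maxOrder_iff, ord_mul hx0 (inv_ne_zero hy0), ord_inv]
    omega
  have h3 := Γ.mul_mem (hdiag (fun _ => x i j * (y i j)⁻¹) fun _ => h2)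
    (single_mem_of_containsDiag hdiag hy i j)
  have h4 : Matrix.diagonal (fun _ => x i j * (y i j)⁻¹) * Matrix.single i j (y i j) =
      Matrix.single i j (x i j) := by
    ext a b
    rw [Matrix.diagonal_mul]
    by_cases hab : i = a ∧ j = b
    · obtain ⟨rfl, rfl⟩ := hab
      simp [hy0]
    · simp [Matrix.single, hab]
  rwa [h4] at h3

namespace IsExponentMatrix

theorem single_zpow_mem (hϖ : IsPrimeElement k ϖ) (h : IsExponentMatrix ϖ Γ μ) (i j : Fin n) :
    Matrix.single i j ((ϖ ^ μ i j : Dˣ) : D) ∈ Γ := by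
  rw [h]
  intro a b
  by_cases hab : i = a ∧ j = b
  · obtain ⟨rfl, rfl⟩ := hab
    simpa using zpow_mem_primePow hϖ le_rfl
  · simpa [Matrix.single, hab] using zero_mem_primePow hϖ _

theorem unique (hϖ : IsPrimeElement k ϖ) {μ' : Matrix (Fin n) (Fin n) ℤ}
    (h : IsExponentMatrix ϖ Γ μ) (h' : IsExponentMatrix ϖ Γ μ') : μ = μ' := by
  have key : ∀ {μ μ' : Matrix (Fin n) (Fin n) ℤ}, IsExponentMatrix ϖ Γ μ →
      IsExponentMatrix ϖ Γ μ' → ∀ i j, μ' i j ≤ μ i j := by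
    intro μ μ' h h' i j
    have h1 := (h' _).mp (h.single_zpow_mem hϖ i j) i j
    rw [Matrix.single_apply_same, mem_primePow_iff hϖ, ord_prime_zpow hϖ] at h1
    exact h1.resolve_left (Units.ne_zero _)
  ext i j
  exact le_antisymm (key h' h i j) (key h h' i j)

theorem exponentMatrix_eq (hϖ : IsPrimeElement k ϖ) (h : IsExponentMatrix ϖ Γ μ) :
    exponentMatrix ϖ Γ = μ := by
  have hex : ∃ μ, IsExponentMatrix ϖ Γ μ := ⟨μ, h⟩
  rw [exponentMatrix, dif_pos hex]
  exact hex.choose_spec.unique hϖ h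

omit [CharZero k] [Algebra.IsCentral k D] [FiniteDimensional k D] [TopologicalSpace k]
  [IsNonarchimedeanLocalField k] in
theorem eq_of (h : IsExponentMatrix ϖ Γ μ) {Γ' : Subalgebra 𝒪[k] (Matrix (Fin n) (Fin n) D)}
    (h' : IsExponentMatrix ϖ Γ' μ) : Γ = Γ' := by
  ext x
  rw [h, h']

theorem le_add (hϖ : IsPrimeElement k ϖ) (h : IsExponentMatrix ϖ Γ μ) (i j l : Fin n) :
    μ i l ≤ μ i j + μ j l := by
  have h1 := (h _).mp (Γ.mul_mem (h.single_zpow_mem hϖ i j) (h.single_zpow_mem hϖ j l)) i l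
  rw [Matrix.single_mul_single_same, Matrix.single_apply_same, mem_primePow_iff hϖ,
    ord_mul (Units.ne_zero _) (Units.ne_zero _), ord_prime_zpow hϖ, ord_prime_zpow hϖ] at h1
  exact h1.resolve_left (mul_ne_zero (Units.ne_zero _) (Units.ne_zero _))

theorem self_eq_zero (hϖ : IsPrimeElement k ϖ) (h : IsExponentMatrix ϖ Γ μ) (i : Fin n) :
    μ i i = 0 := by
  have h1 := (h _).mp Γ.one_mem i i
  rw [Matrix.one_apply_eq, one_mem_primePow_iff hϖ] at h1
  have := h.le_add hϖ i i i
  omega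

end IsExponentMatrix

end Exponents

/-! ### Monomial matrices -/

section Monomial

variable {D : Type*} [DivisionRing D] {n : ℕ}

/-- The diagonal matrix `diag(ϖ ^ b_1, …, ϖ ^ b_n)`. -/
def diagUnit (ϖ : Dˣ) (b : Fin n → ℤ) : GL (Fin n) D :=
  Units.map (Matrix.diagonalRingHom (Fin n) D).toMonoidHom
    (MulEquiv.piUnits.symm fun i => ϖ ^ b i)

theorem coe_diagUnit (ϖ : Dˣ) (b : Fin n → ℤ) :
    (diagUnit ϖ b : Matrix (Fin n) (Fin n) D) = Matrix.diagonal fun i => ((ϖ ^ b i : Dˣ) : D) := rfl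

theorem coe_inv_diagUnit (ϖ : Dˣ) (b : Fin n → ℤ) :
    ((diagUnit ϖ b)⁻¹ : GL (Fin n) D).val = Matrix.diagonal fun i => ((ϖ ^ (-b i) : Dˣ) : D) := by
  simp only [zpow_neg]
  rfl

theorem xi_eq_diagUnit [NeZero n] (ϖ : Dˣ) (s : ℤ) :
    xi (n := n) ϖ s = diagUnit ϖ (Pi.single 0 s) := by
  rw [xi, diagUnit]
  congr 2
  ext i
  by_cases h : i = 0
  · subst h; simp
  · simp [h]

variable (D n) in
/-- The representation of the symmetric group by permutation matrices: `σ` maps the basis vector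
`e_j` to `e_{σ j}`. -/
def permUnit : Equiv.Perm (Fin n) →* GL (Fin n) D :=
  MonoidHom.toHomUnits
    { toFun := fun σ => Matrix.of fun i j => if i = σ j then 1 else 0
      map_one' := by
        ext i j
        simp only [Equiv.Perm.one_apply, Matrix.of_apply, Matrix.one_apply]
        congr
      map_mul' := fun σ τ => by
        ext i j
        rw [Matrix.mul_apply, Finset.sum_eq_single (τ j)]
        · simp only [Matrix.of_apply, Equiv.Perm.mul_apply, if_true, mul_one]
          congr
        · intro b _ hb
          simp [hb]
        · simp }

theorem permUnit_apply (σ : Equiv.Perm (Fin n)) (i j : Fin n) :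
    (permUnit D n σ : Matrix (Fin n) (Fin n) D) i j = if i = σ j then 1 else 0 := rfl

theorem inv_permUnit_mul_apply (σ : Equiv.Perm (Fin n)) (x : Matrix (Fin n) (Fin n) D)
    (i j : Fin n) : (((permUnit D n σ)⁻¹ : GL (Fin n) D).val * x) i j = x (σ i) j := by
  have h : ∀ a, (permUnit D n σ⁻¹ : Matrix (Fin n) (Fin n) D) i a = if a = σ i then 1 else 0 := by
    intro a
    rw [permUnit_apply]
    congr 1
    rw [eq_iff_iff, Equiv.Perm.eq_inv_iff_eq, eq_comm]
  rw [← map_inv, Matrix.mul_apply]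
  simp only [h]
  simp

theorem mul_permUnit_apply (σ : Equiv.Perm (Fin n)) (x : Matrix (Fin n) (Fin n) D)
    (i j : Fin n) : (x * (permUnit D n σ : Matrix (Fin n) (Fin n) D)) i j = x i (σ j) := by
  rw [Matrix.mul_apply]
  simp [permUnit_apply]

theorem inv_permUnit_mul_mul_permUnit (σ : Equiv.Perm (Fin n)) (x : Matrix (Fin n) (Fin n) D) :
    ((permUnit D n σ)⁻¹ : GL (Fin n) D).val * x * (permUnit D n σ : Matrix (Fin n) (Fin n) D) =
      x.submatrix σ σ := by
  ext i j
  rw [mul_permUnit_apply, inv_permUnit_mul_apply, Matrix.submatrix_apply]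

end Monomial

/-! ### Reduced norms of matrices -/

section Norms

open ValuativeRel

variable {k : Type*} [Field k] [CharZero k]
  {D : Type*} [DivisionRing D] [Algebra k D] [Algebra.IsCentral k D] [FiniteDimensional k D]
  {n : ℕ}

theorem reducedNorm_matrix_mul (x y : Matrix (Fin n) (Fin n) D) :
    reducedNorm k (x * y) = reducedNorm k x * reducedNorm k y := by
  obtain ⟨m, -, -, ⟨φ⟩⟩ := exists_splitting (k := k) D
  obtain ⟨Φ, -⟩ := exists_matrix_splitting φ n
  exact reducedNorm_mul Φ x y

variable (k D n) in
theorem reducedNorm_matrix_one : reducedNorm k (1 : Matrix (Fin n) (Fin n) D) = 1 := by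
  obtain ⟨m, -, -, ⟨φ⟩⟩ := exists_splitting (k := k) D
  obtain ⟨Φ, -⟩ := exists_matrix_splitting φ n
  exact reducedNorm_one Φ

variable (k D n) in
/-- The reduced norm as a homomorphism of the groups of units. -/
def reducedNormUnits : GL (Fin n) D →* kˣ :=
  Units.map
    { toFun := fun x => reducedNorm k x
      map_one' := reducedNorm_matrix_one k D n
      map_mul' := reducedNorm_matrix_mul }

theorem coe_reducedNormUnits (x : GL (Fin n) D) :
    (reducedNormUnits k D n x : k) = reducedNorm k (x : Matrix (Fin n) (Fin n) D) := rfl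

variable [ValuativeRel k] [TopologicalSpace k] [IsNonarchimedeanLocalField k] {ϖ : Dˣ}

variable (k D n) in
/-- The valuation of the reduced norm of an invertible matrix. -/
def valNorm : GL (Fin n) D →* Multiplicative ℤ where
  toFun x := Multiplicative.ofAdd (val (reducedNormUnits k D n x : k))
  map_one' := by simp [val_one]
  map_mul' x y := by
    rw [map_mul, Units.val_mul, val_mul (Units.ne_zero _) (Units.ne_zero _), ofAdd_add]

theorem valNorm_apply (x : GL (Fin n) D) :
    (valNorm k D n x).toAdd = val (reducedNorm k (x : Matrix (Fin n) (Fin n) D)) := rfl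

/-- The reduced norms of permutation matrices are roots of unity. -/
theorem valNorm_permUnit (σ : Equiv.Perm (Fin n)) : valNorm k D n (permUnit D n σ) = 1 := by
  have h : (valNorm k D n (permUnit D n σ)) ^ orderOf σ = 1 := by
    rw [← map_pow, ← map_pow, pow_orderOf_eq_one, map_one, map_one]
  exact (pow_eq_one_iff.mp h).resolve_right (orderOf_pos σ).ne'

theorem valNorm_diagUnit (hϖ : IsPrimeElement k ϖ) (b : Fin n → ℤ) :
    (valNorm k D n (diagUnit ϖ b)).toAdd = ∑ i, b i := by
  obtain ⟨m, -, -, ⟨φ⟩⟩ := exists_splitting (k := k) D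
  rw [valNorm_apply, coe_diagUnit, reducedNorm_diagonal φ,
    val_prod _ _ fun i _ => reducedNorm_ne_zero k (Units.ne_zero _)]
  exact Finset.sum_congr rfl fun i _ => ord_prime_zpow hϖ _

theorem val_reducedNorm_nonneg {Γ : Subalgebra 𝒪[k] (Matrix (Fin n) (Fin n) D)}
    (hΓ : (Subalgebra.toSubmodule Γ).FG) {x : GL (Fin n) D}
    (hx : (x : Matrix (Fin n) (Fin n) D) ∈ Γ) : 0 ≤ (valNorm k D n x).toAdd := by
  obtain ⟨m, -, -, ⟨φ⟩⟩ := exists_splitting (k := k) D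
  obtain ⟨Φ, -⟩ := exists_matrix_splitting φ n
  have h1 : IsIntegral 𝒪[k] (x : Matrix (Fin n) (Fin n) D) := IsIntegral.of_mem_of_fg Γ hΓ _ hx
  obtain ⟨y, hy⟩ := IsIntegrallyClosed.isIntegral_iff.mp (isIntegral_reducedNorm Φ h1)
  refine (mem_integer_iff_val (Units.ne_zero (reducedNormUnits k D n x))).mp ?_
  rw [coe_reducedNormUnits, ← hy]
  exact y.2

/-- The units of an order have reduced norms in `Rˣ`. -/
theorem valNorm_eq_one_of_mem {Γ : Subalgebra 𝒪[k] (Matrix (Fin n) (Fin n) D)}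
    (hΓ : (Subalgebra.toSubmodule Γ).FG) {x : GL (Fin n) D}
    (hx : (x : Matrix (Fin n) (Fin n) D) ∈ Γ) (hx' : (x⁻¹ : GL (Fin n) D).val ∈ Γ) :
    valNorm k D n x = 1 := by
  have h1 := val_reducedNorm_nonneg hΓ hx
  have h2 := val_reducedNorm_nonneg hΓ hx'
  rw [map_inv, toAdd_inv] at h2
  apply Multiplicative.toAdd.injective
  rw [toAdd_one]
  omega

variable {Γ : Subalgebra 𝒪[k] (Matrix (Fin n) (Fin n) D)} {μ : Matrix (Fin n) (Fin n) ℤ}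

theorem IsExponentMatrix.conj_diagUnit (hϖ : IsPrimeElement k ϖ) (h : IsExponentMatrix ϖ Γ μ)
    (b : Fin n → ℤ) :
    IsExponentMatrix ϖ (conj (diagUnit ϖ b) Γ) (Matrix.of fun i j => μ i j + b i - b j) := by
  intro x
  rw [mem_conj, h, coe_diagUnit, coe_inv_diagUnit]
  refine forall₂_congr fun i j => ?_
  rw [Matrix.mul_diagonal, Matrix.diagonal_mul, zpow_mul_mul_zpow_mem_primePow hϖ, sub_neg_eq_add]
  rfl

omit [CharZero k] [Algebra.IsCentral k D] [FiniteDimensional k D] [TopologicalSpace k]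
  [IsNonarchimedeanLocalField k] in
theorem IsExponentMatrix.conj_permUnit (h : IsExponentMatrix ϖ Γ μ) (σ : Equiv.Perm (Fin n)) :
    IsExponentMatrix ϖ (conj (permUnit D n σ) Γ) (μ.submatrix σ.symm σ.symm) := by
  intro x
  rw [mem_conj, h, inv_permUnit_mul_mul_permUnit]
  simp only [Matrix.submatrix_apply]
  constructor
  · intro H i j
    simpa using H (σ.symm i) (σ.symm j)
  · intro H i j
    simpa using H (σ i) (σ j)

/-- A monomial matrix that permutes the exponents up to the corresponding shifts normalizes `Γ`. -/
theorem IsExponentMatrix.monomial_mem_normalizer (hϖ : IsPrimeElement k ϖ)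
    (h : IsExponentMatrix ϖ Γ μ) {σ : Equiv.Perm (Fin n)} {b : Fin n → ℤ}
    (hb : ∀ i j, μ (σ i) (σ j) = μ i j + b i - b j) :
    permUnit D n σ * diagUnit ϖ b ∈ normalizer Γ := by
  have h1 := (h.conj_diagUnit hϖ b).conj_permUnit σ
  rw [← conj_mul] at h1
  rw [mem_normalizer]
  refine IsExponentMatrix.eq_of h1 ?_
  convert h
  ext i j
  simp only [Matrix.submatrix_apply, Matrix.of_apply, ← hb, Equiv.apply_symm_apply]

theorem toAdd_valNorm_monomial (hϖ : IsPrimeElement k ϖ) (σ : Equiv.Perm (Fin n))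
    (b : Fin n → ℤ) : (valNorm k D n (permUnit D n σ * diagUnit ϖ b)).toAdd = ∑ i, b i := by
  rw [map_mul, valNorm_permUnit, one_mul, valNorm_diagUnit hϖ]

end Norms

/-! ### Elements of the normalizer -/

section Residues

open ValuativeRel

variable {k : Type*} [Field k] [CharZero k]
  {D : Type*} [DivisionRing D] [Algebra k D] [Algebra.IsCentral k D] [FiniteDimensional k D]
  [ValuativeRel k] [TopologicalSpace k] [IsNonarchimedeanLocalField k] {ϖ : Dˣ}

variable (k) in
open Classical in
/-- The residue class of an element of `Δ`, extended by `0` to `D`. -/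
def residueOrZero (x : D) : ResidueRing k D :=
  if h : x ∈ maxOrderSubalgebra k D then residue k D ⟨x, h⟩ else 0

theorem mem_maxOrderSubalgebra_iff_primePow (hϖ : IsPrimeElement k ϖ) {x : D} :
    x ∈ maxOrderSubalgebra k D ↔ x ∈ primePow k ϖ 0 := by
  rw [mem_primePow_iff hϖ]
  exact mem_maxOrder_iff

theorem residueOrZero_one : residueOrZero k (1 : D) = 1 := by
  rw [residueOrZero, dif_pos (one_mem _)]
  exact map_one (residue k D)

theorem residueOrZero_mul (hϖ : IsPrimeElement k ϖ) {x y : D} (hx : x ∈ primePow k ϖ 0)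
    (hy : y ∈ primePow k ϖ 0) :
    residueOrZero k (x * y) = residueOrZero k x * residueOrZero k y := by
  rw [← mem_maxOrderSubalgebra_iff_primePow hϖ] at hx hy
  rw [residueOrZero, residueOrZero, residueOrZero, dif_pos hx, dif_pos hy,
    dif_pos (mul_mem hx hy), ← map_mul]
  rfl

theorem residueOrZero_sum (hϖ : IsPrimeElement k ϖ) {ι : Type*} (s : Finset ι) (f : ι → D)
    (hf : ∀ i ∈ s, f i ∈ primePow k ϖ 0) :
    residueOrZero k (∑ i ∈ s, f i) = ∑ i ∈ s, residueOrZero k (f i) := by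
  simp only [← mem_maxOrderSubalgebra_iff_primePow hϖ] at hf
  rw [residueOrZero, dif_pos (sum_mem hf), ← Finset.sum_attach s fun i => residueOrZero k (f i)]
  have h : (⟨∑ i ∈ s, f i, sum_mem hf⟩ : maxOrderSubalgebra k D) =
      ∑ i ∈ s.attach, ⟨f i, hf i i.2⟩ := by
    ext
    rw [AddSubmonoidClass.coe_finsetSum, Finset.sum_attach s f]
  rw [h, map_sum]
  exact Finset.sum_congr rfl fun i _ => by rw [residueOrZero, dif_pos (hf i i.2)]

theorem residueOrZero_eq_zero (hϖ : IsPrimeElement k ϖ) {x : D} (hx : x ∈ primePow k ϖ 1) :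
    residueOrZero k x = 0 := by
  rw [mem_primePow_iff hϖ] at hx
  rw [residueOrZero]
  split_ifs with h
  · exact residue_eq_zero_iff.mpr hx
  · rfl

end Residues

section Normalizer

open ValuativeRel

variable {k : Type*} [Field k] [CharZero k]
  {D : Type*} [DivisionRing D] [Algebra k D] [Algebra.IsCentral k D] [FiniteDimensional k D]
  [ValuativeRel k] [TopologicalSpace k] [IsNonarchimedeanLocalField k] {ϖ : Dˣ} {n : ℕ}
  {Γ : Subalgebra 𝒪[k] (Matrix (Fin n) (Fin n) D)} {μ : Matrix (Fin n) (Fin n) ℤ}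

namespace IsExponentMatrix

/-- The comparison of the entries of `x z y ∈ Γ` for the matrix `z` whose only nonzero entry
is `ϖ ^ μ l m`, in position `(l, m)`. -/
theorem le_ord_add_add_ord (hϖ : IsPrimeElement k ϖ) (h : IsExponentMatrix ϖ Γ μ)
    {x y : Matrix (Fin n) (Fin n) D} (hxy : ∀ z ∈ Γ, x * z * y ∈ Γ) {i j l m : Fin n}
    (hx : x i l ≠ 0) (hy : y m j ≠ 0) : μ i j ≤ ord k (x i l) + μ l m + ord k (y m j) := by
  have h1 := (h _).mp (hxy _ (h.single_zpow_mem hϖ l m)) i j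
  have h2 : (x * Matrix.single l m ((ϖ ^ μ l m : Dˣ) : D) * y) i j =
      x i l * ((ϖ ^ μ l m : Dˣ) : D) * y m j := by
    rw [Matrix.mul_apply, Finset.sum_eq_single m]
    · simp
    · intro a _ ha
      rw [Matrix.mul_single_apply_of_ne _ _ _ _ _ ha, zero_mul]
    · simp
  have h3 : x i l * ((ϖ ^ μ l m : Dˣ) : D) ≠ 0 := mul_ne_zero hx (Units.ne_zero _)
  rw [h2, mem_primePow_iff hϖ, ord_mul h3 hy, ord_mul hx (Units.ne_zero _),
    ord_prime_zpow hϖ] at h1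
  exact h1.resolve_left (mul_ne_zero h3 hy)

/-- Every column `j` of an element `ξ` of the normalizer has a dominant entry, in row `τ j` and of
order `b j`: as the diagonal entry `∑ i, ξ⁻¹ j i * ξ i j` of `ξ⁻¹ ξ` is `1` and its terms are
integral, one of them is a unit. The dominant entries bound all entries of `ξ` and `ξ⁻¹`. -/
theorem exists_dominant_entries (hϖ : IsPrimeElement k ϖ) (h : IsExponentMatrix ϖ Γ μ)
    {ξ : GL (Fin n) D} (hξ : ξ ∈ normalizer Γ) :
    ∃ (τ : Fin n → Fin n) (b : Fin n → ℤ), (∀ i j, μ (τ i) (τ j) = μ i j + b i - b j) ∧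
      (∀ i j, (ξ : Matrix (Fin n) (Fin n) D) i j ∈ primePow k ϖ (μ i (τ j) + b j)) ∧
      ∀ i j, (ξ⁻¹ : GL (Fin n) D).val i j ∈ primePow k ϖ (μ (τ i) j - b i) := by
  rw [mem_normalizer] at hξ
  obtain ⟨x, hx⟩ : ∃ x, x = (ξ : Matrix (Fin n) (Fin n) D) := ⟨_, rfl⟩
  obtain ⟨y, hy⟩ : ∃ y, y = (ξ⁻¹ : GL (Fin n) D).val := ⟨_, rfl⟩
  rw [← hx, ← hy]
  have hyx : y * x = 1 := by rw [hx, hy, Units.inv_mul]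
  have F1 : ∀ {i j l m}, x i l ≠ 0 → y m j ≠ 0 → μ i j ≤ ord k (x i l) + μ l m + ord k (y m j) :=
    h.le_ord_add_add_ord hϖ fun z hz => by
      rw [← hξ, mem_conj, ← hx, ← hy, ← mul_assoc, ← mul_assoc, hyx, one_mul, mul_assoc, hyx,
        mul_one]
      exact hz
  have F2 : ∀ {i j l m}, y i l ≠ 0 → x m j ≠ 0 → μ i j ≤ ord k (y i l) + μ l m + ord k (x m j) :=
    h.le_ord_add_add_ord hϖ fun z hz => by
      rw [← hξ, mem_conj, ← hx, ← hy] at hz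
      exact hz
  have hself := h.self_eq_zero hϖ
  have hτ : ∀ l, ∃ i, x i l ≠ 0 ∧ y l i ≠ 0 ∧ ord k (y l i) + ord k (x i l) = 0 := by
    intro l
    by_contra! H
    have h1 : (1 : D) ∈ primePow k ϖ 1 := by
      have h2 : ∑ i, y l i * x i l = 1 := by
        rw [← Matrix.mul_apply, hyx, Matrix.one_apply_eq]
      rw [← h2]
      refine sum_mem_primePow hϖ _ _ fun i _ => (mem_primePow_iff hϖ).mpr ?_
      rw [or_iff_not_imp_left]
      intro h0
      obtain ⟨hy0, hx0⟩ := mul_ne_zero_iff.mp h0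
      have h3 := F2 hy0 hx0
      have h4 := H i hx0 hy0
      rw [hself, hself] at h3
      rw [ord_mul hy0 hx0]
      omega
    rw [one_mem_primePow_iff hϖ] at h1
    omega
  choose τ hx0 hy0 hτ using hτ
  refine ⟨τ, fun l => ord k (x (τ l) l), fun i j => ?_, fun i j => ?_, fun i j => ?_⟩
  · have h1 := F1 (hx0 i) (hy0 j)
    have h2 := F2 (hy0 i) (hx0 j)
    have := hτ i
    have := hτ j
    dsimp only
    omega
  · rw [mem_primePow_iff hϖ, or_iff_not_imp_left]
    intro h0
    have h1 := F1 h0 (hy0 j)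
    have := hτ j
    have := hself j
    dsimp only
    omega
  · rw [mem_primePow_iff hϖ, or_iff_not_imp_left]
    intro h0
    have h1 := F1 (hx0 i) h0
    have := hself i
    dsimp only
    omega

/-- The dominant entries can be rearranged to a permutation. Call `i` and `j` equivalent if
`μ i j + μ j i = 0`; over an equivalence class `Γ` is a matrix ring over `Δ`. Reduction modulo `𝔭`
of the blocks of `x` and `y` given by the classes produces inverse matrices over the residue field,
and a term of the determinant that does not vanish gives the permutation. -/
theorem exists_perm_equivalent (hϖ : IsPrimeElement k ϖ) (h : IsExponentMatrix ϖ Γ μ)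
    {x y : Matrix (Fin n) (Fin n) D} (hxy : x * y = 1) {τ : Fin n → Fin n} {b : Fin n → ℤ}
    (hx : ∀ i j, x i j ∈ primePow k ϖ (μ i (τ j) + b j))
    (hy : ∀ i j, y i j ∈ primePow k ϖ (μ (τ i) j - b i)) :
    ∃ σ : Equiv.Perm (Fin n), ∀ j, μ (σ j) (τ j) + μ (τ j) (σ j) = 0 := by
  classical
  rcases Nat.eq_zero_or_pos n with hn | hn
  · subst hn
    exact ⟨1, fun j => j.elim0⟩
  have hself := h.self_eq_zero hϖ
  have hle := h.le_add hϖ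
  -- on an equivalence class `μ i j = α i - α j`
  let α : Fin n → ℤ := fun i => μ i ⟨0, hn⟩
  have hα : ∀ {i j}, μ i j + μ j i = 0 → μ i j = α i - α j := by
    intro i j hij
    have h1 := hle i j ⟨0, hn⟩
    have h2 := hle j i ⟨0, hn⟩
    change μ i j = μ i ⟨0, hn⟩ - μ j ⟨0, hn⟩
    omega
  let x' : Matrix (Fin n) (Fin n) D := Matrix.of fun i j =>
    ((ϖ ^ (-α i) : Dˣ) : D) * x i j * ((ϖ ^ (α (τ j) - b j) : Dˣ) : D)
  let y' : Matrix (Fin n) (Fin n) D := Matrix.of fun i j =>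
    ((ϖ ^ (b i - α (τ i)) : Dˣ) : D) * y i j * ((ϖ ^ (α j) : Dˣ) : D)
  have hx' : ∀ i j, x' i j ∈ primePow k ϖ (μ i (τ j) - α i + α (τ j)) := fun i j => by
    refine (zpow_mul_mul_zpow_mem_primePow hϖ).mpr ?_
    convert hx i j using 2
    ring
  have hy' : ∀ i j, y' i j ∈ primePow k ϖ (μ (τ i) j - α (τ i) + α j) := fun i j => by
    refine (zpow_mul_mul_zpow_mem_primePow hϖ).mpr ?_
    convert hy i j using 2
    ring
  have hxy' : ∀ i j m, x' i m * y' m j =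
      ((ϖ ^ (-α i) : Dˣ) : D) * (x i m * y m j) * ((ϖ ^ (α j) : Dˣ) : D) := fun i j m => by
    have h1 : ((ϖ ^ (α (τ m) - b m) : Dˣ) : D) * ((ϖ ^ (b m - α (τ m)) : Dˣ) : D) = 1 := by
      rw [← Units.val_mul, ← zpow_add, sub_add_sub_cancel, sub_self, zpow_zero, Units.val_one]
    simp only [x', y', Matrix.of_apply, mul_assoc]
    rw [← mul_assoc _ _ (y m j * _), h1, one_mul]
  let X : Matrix (Fin n) (Fin n) (ResidueRing k D) := Matrix.of fun i j =>
    if μ i (τ j) + μ (τ j) i = 0 then residueOrZero k (x' i j) else 0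
  let Y : Matrix (Fin n) (Fin n) (ResidueRing k D) := Matrix.of fun i j =>
    if μ (τ i) j + μ j (τ i) = 0 then residueOrZero k (y' i j) else 0
  have hXY : X * Y = 1 := by
    ext i j
    rw [Matrix.mul_apply]
    by_cases hij : μ i j + μ j i = 0
    · have hmem : ∀ m, x' i m * y' m j ∈ primePow k ϖ (μ i (τ m) + μ (τ m) i) := fun m => by
        refine mul_mem_primePow hϖ (hx' i m) (hy' m j) ?_
        have := hα hij
        have := hle (τ m) j i
        omega
      have hterm : ∀ m, X i m * Y m j = residueOrZero k (x' i m * y' m j) := by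
        intro m
        simp only [X, Y, Matrix.of_apply]
        have h1 := hle i (τ m) i
        have h2 := hle (τ m) i j
        have h3 := hle j i (τ m)
        have h4 := hle (τ m) j i
        have h5 := hle i j (τ m)
        have h0 := hself i
        by_cases him : μ i (τ m) + μ (τ m) i = 0
        · have hmj : μ (τ m) j + μ j (τ m) = 0 := by omega
          rw [if_pos him, if_pos hmj, residueOrZero_mul hϖ]
          · convert hx' i m using 2
            rw [hα him]
            ring
          · convert hy' m j using 2
            rw [hα hmj]
            ring
        · rw [if_neg him, zero_mul, residueOrZero_eq_zero hϖ]
          have h6 := hmem m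
          rw [mem_primePow_iff hϖ] at h6 ⊢
          exact h6.imp_right fun h7 => by omega
      simp only [hterm]
      rw [← residueOrZero_sum hϖ]
      · simp only [hxy']
        rw [← Finset.sum_mul, ← Finset.mul_sum, ← Matrix.mul_apply, hxy]
        by_cases hij' : i = j
        · subst hij'
          rw [Matrix.one_apply_eq, mul_one, ← Units.val_mul, ← zpow_add, neg_add_cancel, zpow_zero,
            Units.val_one, residueOrZero_one, Matrix.one_apply_eq]
        · rw [Matrix.one_apply_ne hij', Matrix.one_apply_ne hij', mul_zero, zero_mul,
            residueOrZero_eq_zero hϖ (zero_mem_primePow hϖ 1)]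
      · intro m _
        have h6 := hmem m
        have h1 := hle i (τ m) i
        have h0 := hself i
        rw [mem_primePow_iff hϖ] at h6 ⊢
        exact h6.imp_right fun h7 => by omega
    · have hij' : i ≠ j := by
        rintro rfl
        exact hij (by rw [hself, add_zero])
      rw [Matrix.one_apply_ne hij']
      refine Finset.sum_eq_zero fun m _ => ?_
      simp only [X, Y, Matrix.of_apply]
      by_cases him : μ i (τ m) + μ (τ m) i = 0
      · have hmj : ¬ μ (τ m) j + μ j (τ m) = 0 := by
          have h1 := hle i (τ m) j
          have h2 := hle j (τ m) i
          have h3 := hle i j i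
          have h0 := hself i
          omega
        rw [if_neg hmj, mul_zero]
      · rw [if_neg him, zero_mul]
  have hdet : X.det ≠ 0 := by
    intro h0
    have h1 : (X * Y).det = 1 := by rw [hXY, Matrix.det_one]
    rw [Matrix.det_mul, h0, zero_mul] at h1
    exact zero_ne_one h1
  rw [Matrix.det_apply] at hdet
  obtain ⟨σ, -, hσ⟩ := Finset.exists_ne_zero_of_sum_ne_zero hdet
  refine ⟨σ, fun j => ?_⟩
  by_contra hj
  refine hσ ?_
  rw [Finset.prod_eq_zero (Finset.mem_univ j) (if_neg hj), smul_zero]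

/-- The valuation of the reduced norm of an element of the normalizer is that of a monomial matrix
in the normalizer, because the quotient of the two is a unit of `Γ`. -/
theorem exists_monomial_of_mem_normalizer (hϖ : IsPrimeElement k ϖ) (h : IsExponentMatrix ϖ Γ μ)
    (hΓ : (Subalgebra.toSubmodule Γ).FG) {ξ : GL (Fin n) D} (hξ : ξ ∈ normalizer Γ) :
    ∃ (σ : Equiv.Perm (Fin n)) (b : Fin n → ℤ), (∀ i j, μ (σ i) (σ j) = μ i j + b i - b j) ∧
      (valNorm k D n ξ).toAdd = ∑ i, b i := by
  obtain ⟨τ, b, hb, hx, hy⟩ := h.exists_dominant_entries hϖ hξ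
  obtain ⟨σ, hσ⟩ := h.exists_perm_equivalent hϖ (Units.mul_inv ξ) hx hy
  have hle := h.le_add hϖ
  let b' : Fin n → ℤ := fun j => b j + μ (σ j) (τ j)
  have hb' : ∀ i j, μ (σ i) (σ j) = μ i j + b' i - b' j := by
    intro i j
    have h1 := hb i j
    have h2 := hσ i
    have h3 := hσ j
    have h4 := hle (σ i) (τ i) (τ j)
    have h5 := hle (σ i) (τ j) (σ j)
    have h6 := hle (τ i) (σ i) (σ j)
    have h7 := hle (τ i) (σ j) (τ j)
    simp only [b']
    omega
  refine ⟨σ, b', hb', ?_⟩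
  obtain ⟨w, hw⟩ : ∃ w, w = permUnit D n σ * diagUnit ϖ b' := ⟨_, rfl⟩
  have hw1 : ∀ z : Matrix (Fin n) (Fin n) D, ∀ i j, ((w⁻¹ : GL (Fin n) D).val * z) i j =
      ((ϖ ^ (-b' i) : Dˣ) : D) * z (σ i) j := by
    intro z i j
    rw [hw, mul_inv_rev, Units.val_mul, coe_inv_diagUnit, mul_assoc, Matrix.diagonal_mul,
      inv_permUnit_mul_apply]
  have hw2 : ∀ z : Matrix (Fin n) (Fin n) D, ∀ i j,
      (z * (w : Matrix (Fin n) (Fin n) D)) i j = z i (σ j) * ((ϖ ^ (b' j) : Dˣ) : D) := by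
    intro z i j
    rw [hw, Units.val_mul, coe_diagUnit, ← mul_assoc, Matrix.mul_diagonal, mul_permUnit_apply]
  have h1 : valNorm k D n (w⁻¹ * ξ) = 1 := by
    refine valNorm_eq_one_of_mem hΓ ((h _).mpr fun i j => ?_) ((h _).mpr fun i j => ?_)
    · rw [Units.val_mul, hw1]
      refine mul_mem_primePow hϖ (zpow_mem_primePow hϖ le_rfl) (hx _ _) ?_
      have := hb i j
      have := hle (τ i) (σ i) (τ j)
      have := hσ i
      simp only [b']
      omega
    · rw [mul_inv_rev, inv_inv, Units.val_mul, hw2]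
      refine mul_mem_primePow hϖ (hy _ _) (zpow_mem_primePow hϖ le_rfl) ?_
      have := hb i j
      have := hle (τ i) (σ j) (τ j)
      simp only [b']
      omega
  rw [← toAdd_valNorm_monomial hϖ σ b', ← hw, ← mul_inv_cancel_left w ξ, map_mul, h1, mul_one]

end IsExponentMatrix

end Normalizer

/-! ### Symmetries of exponent matrices -/

section ShiftGroup

variable {n : ℕ}

/-- The group of the integers `∑ b i`, where `b` runs over the shifts that occur in the symmetries
`μ (σ i) (σ j) = μ i j + b i - b j` of an integer matrix `μ`. -/
def shiftGroup (μ : Matrix (Fin n) (Fin n) ℤ) : AddSubgroup ℤ where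
  carrier := {c | ∃ (σ : Equiv.Perm (Fin n)) (b : Fin n → ℤ),
    (∀ i j, μ (σ i) (σ j) = μ i j + b i - b j) ∧ ∑ i, b i = c}
  zero_mem' := ⟨1, 0, by simp, by simp⟩
  add_mem' := by
    rintro _ _ ⟨σ, b, hb, rfl⟩ ⟨τ, c, hc, rfl⟩
    refine ⟨σ * τ, fun i => b (τ i) + c i, fun i j => ?_, ?_⟩
    · rw [Equiv.Perm.mul_apply, Equiv.Perm.mul_apply, hb, hc]
      ring
    · rw [Finset.sum_add_distrib, Equiv.sum_comp τ b]
  neg_mem' := by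
    rintro _ ⟨σ, b, hb, rfl⟩
    refine ⟨σ⁻¹, fun i => -b (σ⁻¹ i), fun i j => ?_, ?_⟩
    · have h1 := hb (σ⁻¹ i) (σ⁻¹ j)
      rw [← Equiv.Perm.mul_apply, ← Equiv.Perm.mul_apply, mul_inv_cancel, Equiv.Perm.one_apply,
        Equiv.Perm.one_apply] at h1
      linarith
    · rw [Finset.sum_neg_distrib, Equiv.sum_comp σ⁻¹ b]

theorem mem_shiftGroup {μ : Matrix (Fin n) (Fin n) ℤ} {c : ℤ} :
    c ∈ shiftGroup μ ↔ ∃ (σ : Equiv.Perm (Fin n)) (b : Fin n → ℤ),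
      (∀ i j, μ (σ i) (σ j) = μ i j + b i - b j) ∧ ∑ i, b i = c := Iff.rfl

/-- The generator of the group of shifts divides `n`, because the constant shift `b = (1, …, 1)`
belongs to the identity permutation. -/
theorem exists_mem_shiftGroup_iff_dvd [NeZero n] (μ : Matrix (Fin n) (Fin n) ℤ) :
    ∃ e : ℕ, 0 < e ∧ e ≤ n ∧ ∀ c, c ∈ shiftGroup μ ↔ (e : ℤ) ∣ c := by
  obtain ⟨a, ha⟩ := Int.subgroup_cyclic (shiftGroup μ)
  have h : ∀ c, c ∈ shiftGroup μ ↔ (a.natAbs : ℤ) ∣ c := by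
    intro c
    rw [ha, ← AddSubgroup.zmultiples_eq_closure, Int.mem_zmultiples_iff, Int.natAbs_dvd]
  have hn : a.natAbs ∣ n := by
    rw [← Int.natCast_dvd_natCast, ← h]
    exact ⟨1, 1, by simp, by simp⟩
  exact ⟨a.natAbs, Nat.pos_of_dvd_of_pos hn (NeZero.pos n), Nat.le_of_dvd (NeZero.pos n) hn, h⟩

/-- If the fibres of `f : ℤ → α` are the residue classes modulo `e`, then `f` has `e` values, and
these are attained on `{0, …, n - 1}` as soon as `e ≤ n`. -/
theorem ncard_range_eq_of_fibres {α : Type*} {f : ℤ → α} {e : ℕ} (he : 0 < e) (hen : e ≤ n)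
    (hf : ∀ s t, f s = f t ↔ (e : ℤ) ∣ t - s) : (Set.range fun s : Fin n => f s).ncard = e := by
  have h1 : (Set.range fun s : Fin n => f s) = Set.range fun s : Fin e => f s := by
    ext y
    constructor
    · rintro ⟨s, rfl⟩
      refine ⟨⟨s % e, Nat.mod_lt _ he⟩, ?_⟩
      rw [hf]
      have := Int.dvd_self_sub_emod (x := (s : ℤ)) (m := e)
      simpa using this
    · rintro ⟨s, rfl⟩
      exact ⟨⟨s, s.2.trans_le hen⟩, rfl⟩
  have h2 : Function.Injective fun s : Fin e => f s := by
    intro s t hst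
    have h4 : (s : ℤ) ≡ t [ZMOD e] := Int.modEq_iff_dvd.mpr ((hf _ _).mp hst)
    exact Fin.ext (Nat.ModEq.eq_of_lt_of_lt (Int.natCast_modEq_iff.mp h4) s.2 t.2)
  rw [h1, Set.ncard_range_of_injective h2, Nat.card_fin]

end ShiftGroup

/-! ### Reflection classes -/

section ReflectionClass

open ValuativeRel

variable {k : Type*} [Field k] [CharZero k]
  {D : Type*} [DivisionRing D] [Algebra k D] [Algebra.IsCentral k D] [FiniteDimensional k D]
  [ValuativeRel k] [TopologicalSpace k] [IsNonarchimedeanLocalField k] {ϖ : Dˣ} {n : ℕ}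
  {Γ : Subalgebra 𝒪[k] (Matrix (Fin n) (Fin n) D)} {μ : Matrix (Fin n) (Fin n) ℤ} [NeZero n]

/-- The conjugation by `ξ_s` does not change the structural invariants and shifts the types by
`s`. A permutation that preserves the structural invariants is a symmetry of `μ` up to shifts `b`,
and it changes the types by `∑ b i`, which is well defined modulo `n`. -/
theorem IsExponentMatrix.reflectionClass_eq_iff (hϖ : IsPrimeElement k ϖ)
    (h : IsExponentMatrix ϖ Γ μ) (s t : ℤ) :
    reflectionClass ϖ Γ s = reflectionClass ϖ Γ t ↔ t - s ∈ shiftGroup μ := by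
  have hexp : ∀ s, exponentMatrix ϖ (conj (xi ϖ s) Γ) = Matrix.of fun i j =>
      μ i j + (Pi.single 0 s : Fin n → ℤ) i - (Pi.single 0 s : Fin n → ℤ) j := fun s => by
    rw [xi_eq_diagUnit]
    exact (h.conj_diagUnit hϖ _).exponentMatrix_eq hϖ
  have hinv : ∀ s i j l, structInv ϖ (conj (xi ϖ s) Γ) i j l = μ i j + μ j l - μ i l := by
    intro s i j l
    simp only [structInv, hexp, Matrix.of_apply]
    ring
  have htype : ∀ s j, distinguishedType ϖ (conj (xi ϖ s) Γ) j =
      ((∑ i, μ i j + s : ℤ) : ZMod n) := by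
    intro s j
    simp only [distinguishedType, vertexType, hexp, Matrix.of_apply]
    rw [Finset.sum_sub_distrib, Finset.sum_add_distrib, Finset.sum_pi_single', Finset.sum_const,
      Finset.card_univ, Fintype.card_fin]
    simp
  have hsum : ∀ {σ : Equiv.Perm (Fin n)} {b : Fin n → ℤ},
      (∀ i j, μ (σ i) (σ j) = μ i j + b i - b j) → ∀ j,
      ∑ i, μ i (σ j) = ∑ i, μ i j + ∑ i, b i - n * b j := by
    intro σ b hb j
    rw [← Equiv.sum_comp σ]
    simp only [hb]
    rw [Finset.sum_sub_distrib, Finset.sum_add_distrib, Finset.sum_const, Finset.card_univ,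
      Fintype.card_fin, nsmul_eq_mul]
  have hrel : reflectionClass ϖ Γ s = reflectionClass ϖ Γ t ↔ ∃ σ : Equiv.Perm (Fin n),
      (∀ i j l, μ i j + μ j l - μ i l = μ (σ i) (σ j) + μ (σ j) (σ l) - μ (σ i) (σ l)) ∧
      ∀ i, ((∑ j, μ j i + t : ℤ) : ZMod n) = ((∑ j, μ j (σ i) + s : ℤ) : ZMod n) := by
    refine Quotient.eq.trans (exists_congr fun σ => and_congr ?_ ?_)
    · exact forall₃_congr fun i j l => by rw [hinv, hinv]
    · exact forall_congr' fun i => by rw [htype, htype]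
  rw [hrel, mem_shiftGroup]
  constructor
  · rintro ⟨σ, hσ, hT⟩
    have hb : ∀ i j, μ (σ i) (σ j) =
        μ i j + (μ (σ i) (σ 0) - μ i 0) - (μ (σ j) (σ 0) - μ j 0) := fun i j => by
      have := hσ i j 0
      omega
    have h1 := hT 0
    rw [hsum hb, ZMod.intCast_eq_intCast_iff_dvd_sub] at h1
    obtain ⟨c, hc⟩ := h1
    -- the shifts are determined up to a constant, which is used to correct their sum
    refine ⟨σ, fun i => μ (σ i) (σ 0) - μ i 0 - (c + (μ (σ 0) (σ 0) - μ 0 0)), fun i j => ?_, ?_⟩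
    · rw [hb]
      ring
    · rw [Finset.sum_sub_distrib, Finset.sum_const, Finset.card_univ, Fintype.card_fin,
        nsmul_eq_mul]
      linarith
  · rintro ⟨σ, b, hb, hbs⟩
    refine ⟨σ, fun i j l => by rw [hb, hb, hb]; ring, fun i => ?_⟩
    rw [hsum hb, ZMod.intCast_eq_intCast_iff_dvd_sub]
    exact ⟨-b i, by rw [hbs]; ring⟩

end ReflectionClass

/-! ### Reduced norms of the normalizer -/

section NormalizerNorms

open ValuativeRel

variable {k : Type*} [Field k] [ValuativeRel k] [TopologicalSpace k]
  [IsNonarchimedeanLocalField k]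

theorem powMulUnits_injective : Function.Injective (powMulUnits k) := by
  have key : ∀ {d e : ℕ}, powMulUnits k d = powMulUnits k e → d ∣ e := by
    intro d e h
    obtain ⟨a, ha0, ha⟩ := exists_val_eq_one (k := k)
    have h1 : a ^ e ∈ powMulUnits k e := mem_powMulUnits_iff.mpr
      ⟨pow_ne_zero _ ha0, by rw [val_pow ha0, ha, mul_one]⟩
    rw [← h, mem_powMulUnits_iff, val_pow ha0, ha, mul_one] at h1
    exact_mod_cast h1.2
  exact fun d e h => Nat.dvd_antisymm (key h) (key h.symm)

variable [CharZero k]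
  {D : Type*} [DivisionRing D] [Algebra k D] [Algebra.IsCentral k D] [FiniteDimensional k D]
  {ϖ : Dˣ} {n : ℕ}
  {Γ : Subalgebra 𝒪[k] (Matrix (Fin n) (Fin n) D)} {μ : Matrix (Fin n) (Fin n) ℤ}

/-- Every unit of `R` is the reduced norm of a unit `diag(x, 1, …, 1)` of `Γ`. -/
theorem exists_mem_normalizer_reducedNorm_eq [NeZero n] (hϖ : IsPrimeElement k ϖ)
    (hdiag : ContainsDiag Γ) {u : k} (hu : u ≠ 0) (hu0 : val u = 0) :
    ∃ δ : GL (Fin n) D, δ ∈ normalizer Γ ∧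
      reducedNorm k (δ : Matrix (Fin n) (Fin n) D) = u := by
  obtain ⟨x, hx⟩ := exists_reducedNorm_eq hϖ hu hu0
  obtain ⟨m, -, -, ⟨φ⟩⟩ := exists_splitting (k := k) D
  have hx0 : ord k (x : D) = 0 := by rw [ord, hx, hu0]
  let δ : Dˣ → GL (Fin n) D := fun x => Units.map (Matrix.diagonalRingHom (Fin n) D).toMonoidHom
    (MulEquiv.piUnits.symm (Pi.mulSingle 0 x))
  have hδ : ∀ x, (δ x : Matrix (Fin n) (Fin n) D) =
      Matrix.diagonal fun i => ((Pi.mulSingle 0 x : Fin n → Dˣ) i : D) := fun x => rfl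
  have hδmem : ∀ x : Dˣ, ord k (x : D) = 0 → (δ x : Matrix (Fin n) (Fin n) D) ∈ Γ := by
    intro x hx
    rw [hδ]
    refine hdiag _ fun i => mem_maxOrder_iff.mpr (Or.inr ?_)
    by_cases hi : i = 0
    · subst hi
      rw [Pi.mulSingle_eq_same, hx]
    · rw [Pi.mulSingle_eq_of_ne hi, Units.val_one, ord_one]
  have hδinv : (δ x)⁻¹ = δ x⁻¹ := by
    simp only [δ]
    rw [Pi.mulSingle_inv, map_inv, map_inv]
  refine ⟨δ x, conj_eq_self_of_mem (hδmem x hx0) ?_, ?_⟩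
  · rw [hδinv]
    refine hδmem _ ?_
    rw [Units.val_inv_eq_inv_val, ord_inv, hx0, neg_zero]
  · rw [hδ, reducedNorm_diagonal φ, Finset.prod_eq_single 0]
    · rw [Pi.mulSingle_eq_same, hx]
    · intro i _ hi
      rw [Pi.mulSingle_eq_of_ne hi, Units.val_one, reducedNorm_one_of_divisionRing]
    · simp

omit [TopologicalSpace k] [IsNonarchimedeanLocalField k] in
theorem image_reducedNorm_normalizer_conj (g : GL (Fin n) D) :
    (fun x : GL (Fin n) D => reducedNorm k (x : Matrix (Fin n) (Fin n) D)) ''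
      normalizer (conj g Γ) =
    (fun x : GL (Fin n) D => reducedNorm k (x : Matrix (Fin n) (Fin n) D)) '' normalizer Γ := by
  have hnr : ∀ g x : GL (Fin n) D, reducedNorm k ((g * x * g⁻¹ : GL (Fin n) D).val) =
      reducedNorm k (x : Matrix (Fin n) (Fin n) D) := by
    intro g x
    rw [← coe_reducedNormUnits, map_mul, map_mul, map_inv, mul_right_comm, mul_inv_cancel,
      one_mul, coe_reducedNormUnits]
  ext y
  constructor
  · rintro ⟨x, hx, rfl⟩
    exact ⟨_, mem_normalizer_conj.mp hx, by simpa using hnr g⁻¹ x⟩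
  · rintro ⟨x, hx, rfl⟩
    refine ⟨g * x * g⁻¹, mem_normalizer_conj.mpr ?_, hnr g x⟩
    simpa [mul_assoc] using hx

/-- The valuations of the reduced norms of the normalizer form the group of shifts. -/
theorem IsExponentMatrix.mem_image_reducedNorm_normalizer_iff [NeZero n]
    (hϖ : IsPrimeElement k ϖ) (h : IsExponentMatrix ϖ Γ μ)
    (hΓ : (Subalgebra.toSubmodule Γ).FG) (hdiag : ContainsDiag Γ) {y : k} :
    y ∈ (fun x : GL (Fin n) D => reducedNorm k (x : Matrix (Fin n) (Fin n) D)) '' normalizer Γ ↔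
      y ≠ 0 ∧ val y ∈ shiftGroup μ := by
  constructor
  · rintro ⟨ξ, hξ, rfl⟩
    obtain ⟨σ, b, hb, hs⟩ := h.exists_monomial_of_mem_normalizer hϖ hΓ hξ
    exact ⟨Units.ne_zero (reducedNormUnits k D n ξ), σ, b, hb, hs.symm⟩
  · rintro ⟨hy0, σ, b, hb, hs⟩
    have hw := h.monomial_mem_normalizer hϖ hb
    have hval := toAdd_valNorm_monomial (k := k) hϖ σ b
    rw [hs, valNorm_apply] at hval
    have hw0 := Units.ne_zero (reducedNormUnits k D n (permUnit D n σ * diagUnit ϖ b))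
    rw [coe_reducedNormUnits] at hw0
    obtain ⟨δ, hδ, hδy⟩ := exists_mem_normalizer_reducedNorm_eq hϖ hdiag
      (mul_ne_zero (inv_ne_zero hw0) hy0)
      (by rw [val_mul (inv_ne_zero hw0) hy0, val_inv, hval, neg_add_cancel])
    refine ⟨permUnit D n σ * diagUnit ϖ b * δ, ?_, ?_⟩
    · rw [mem_normalizer] at hw hδ ⊢
      rw [conj_mul, hδ, hw]
    · simp only
      rw [Units.val_mul, reducedNorm_matrix_mul, hδy, mul_inv_cancel_left₀ hw0]

end NormalizerNorms

end TiledOrder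

end

theorem mainTheorem1
    {k : Type*} [Field k] [CharZero k] [ValuativeRel k] [TopologicalSpace k]
    [IsNonarchimedeanLocalField k]
    {D : Type*} [DivisionRing D] [Algebra k D] [Algebra.IsCentral k D] [FiniteDimensional k D]
    (ϖ : Dˣ) (hϖ : TiledOrder.IsPrimeElement k ϖ)
    {n : ℕ} [NeZero n]
    (Γ : Subalgebra 𝒪[k] (Matrix (Fin n) (Fin n) D)) (hΓ : TiledOrder.IsTiled Γ)
    (g : GL (Fin n) D) (hg : TiledOrder.ContainsDiag (TiledOrder.conj g Γ))
    (d : ℕ) :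
    List.TFAE
      [(Set.range fun s : Fin n =>
          TiledOrder.reflectionClass ϖ (TiledOrder.conj g Γ) (s : ℤ)).ncard = d,
        IsLeast {e : ℕ | 1 ≤ e ∧ e ≤ n ∧ ∀ s t : ℤ, s ≡ t [ZMOD e] →
          TiledOrder.reflectionClass ϖ (TiledOrder.conj g Γ) s =
            TiledOrder.reflectionClass ϖ (TiledOrder.conj g Γ) t} d,
        IsLeast {e : ℕ | 1 ≤ e ∧ e ≤ n ∧
          TiledOrder.reflectionClass ϖ (TiledOrder.conj g Γ) 0 =
            TiledOrder.reflectionClass ϖ (TiledOrder.conj g Γ) (e : ℤ)} d,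
        (fun x : GL (Fin n) D =>
            TiledOrder.reducedNorm k (x : Matrix (Fin n) (Fin n) D)) ''
          TiledOrder.normalizer Γ = TiledOrder.powMulUnits k d] := by
  have hord := hΓ.1.conj g
  obtain ⟨μ, hμ⟩ := TiledOrder.exists_isExponentMatrix hϖ hord hg
  obtain ⟨e, he0, hen, he⟩ := TiledOrder.exists_mem_shiftGroup_iff_dvd μ
  have hclass : ∀ s t, TiledOrder.reflectionClass ϖ (TiledOrder.conj g Γ) s =
      TiledOrder.reflectionClass ϖ (TiledOrder.conj g Γ) t ↔ (e : ℤ) ∣ t - s := fun s t =>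
    (hμ.reflectionClass_eq_iff hϖ s t).trans (he _)
  have hnorm : (fun x : GL (Fin n) D =>
      TiledOrder.reducedNorm k (x : Matrix (Fin n) (Fin n) D)) '' TiledOrder.normalizer Γ =
        TiledOrder.powMulUnits k e := by
    ext y
    rw [← TiledOrder.image_reducedNorm_normalizer_conj g,
      hμ.mem_image_reducedNorm_normalizer_iff hϖ hord.fg hg, he, TiledOrder.mem_powMulUnits_iff]
  have hleast : IsLeast {m : ℕ | 1 ≤ m ∧ m ≤ n ∧ e ∣ m} e :=
    ⟨⟨he0, hen, dvd_rfl⟩, fun _ hm => Nat.le_of_dvd hm.1 hm.2.2⟩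
  have hleast_iff : IsLeast {m : ℕ | 1 ≤ m ∧ m ≤ n ∧ e ∣ m} d ↔ d = e :=
    ⟨fun h => h.unique hleast, fun h => h ▸ hleast⟩
  have hb : ∀ m : ℕ, (∀ s t : ℤ, s ≡ t [ZMOD m] → (e : ℤ) ∣ t - s) ↔ e ∣ m := by
    intro m
    constructor
    · intro h
      have := h 0 m (by rw [Int.modEq_iff_dvd, sub_zero])
      rwa [sub_zero, Int.natCast_dvd_natCast] at this
    · exact fun h s t hst => (Int.natCast_dvd_natCast.mpr h).trans (Int.modEq_iff_dvd.mp hst)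
  -- each of the four statements says that `d = e`
  rw [TiledOrder.ncard_range_eq_of_fibres he0 hen hclass, hnorm]
  simp only [hclass, hb, sub_zero, Int.natCast_dvd_natCast, hleast_iff,
    TiledOrder.powMulUnits_injective.eq_iff]
  tfae_have 1 ↔ 2 := eq_comm
  tfae_have 2 ↔ 3 := Iff.rfl
  tfae_have 1 ↔ 4 := Iff.rfl
  tfae_finish
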